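/- Fix an integer $r\ge 2$. \textbf{Max $r$-CSP.} An instance consists of $n$ Boolean variables and a collection (repetitions allowed) of $m$ Boolean functions, each given by its truth table and acting on a list of at most $r$ distinct variables, together with a parameter $k\in\mathbb{N}$. The question is whether some truth assignment satisfies at least $E+k2^{-r}$ of the functions, where $E$ is the average number of satisfied functions over all $2^n$ truth assignments. \textbf{Max $r$-Lin AA.} An instance consists of a system of linear equations over $\mathbb{F}_2$ in $n'$ variables, each equation having at most $r$ variables and a positive integral weight, together with a parameter $k'\in\mathbb{N}$. The question is whether some assignment has excess (total weight of satisfied equations minus total weight of falsified equations) at least $k'$. A \emph{bikernelization} from Max $r$-CSP to Max $r$-Lin AA is a polynomial-time algorithm that maps each instance $(x,k)$ of the former to an instance $(x',k')$ of the latter (the \emph{bikernel}) such that (i) $(x,k)$ is a yes-instance if and only if $(x',k')$ is, (ii) $k'\le f(k)$ and (iii) $|x'|\le s(k)$ for some functions $f,s:\mathbb{N}\to\mathbb{N}$. Here $|x|$ is the size of the encoding of $x$; numbers are written in binary. Then: (a) There is a bikernelization from Max $r$-CSP to Max $r$-Lin AA whose bikernels have $O(k\log k)$ variables, i.e. $n'\le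 g(k)$ for all instances, for some $g:\mathbb{N}\to\mathbb{N}$ with $g(k)=O(k\log k)$ as $k\to\infty$. (b) There is an algorithm that decides Max $r$-CSP in time at most $2^{g(k)}+P(|x|)$ on every instance $(x,k)$, and in time at most $2^{g(k)}+Q(m)$ if every variable of $x$ occurs in one of its functions, for some polynomials $P,Q$ and some $g:\mathbb{N}\to\mathbb{N}$ with $g(k)=O(k\log k)$ as $k\to\infty$. Thus Max $r$-CSP is solvable in time $2^{O(k\log k)}+m^{O(1)}$. -/

import Mathlib

open Filter Asymptotics

/-! ### The model of computation

Data are finite binary trees, in which lists, numbers and so on are written in the usual way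
(as LISP does).  Programs are built from the elementary tree operations by composition, pairing,
branching and unbounded loops.  Every elementary operation, every duplication of a value and every
test is charged the size of the tree that it handles (plus one).  Hence the running time bounds the
sizes of all values that occur, and the model and multitape Turing machines simulate each other with
polynomial overhead. -/

/-- Binary trees, the data of programs. -/
inductive BTree : Type
  | nil : BTree
  | cons : BTree → BTree → BTree

/-- The size of a tree: the number of its nodes, leaves included. -/
def BTree.size : BTree → ℕ
  | .nil => 1
  | .cons a b => a.size + b.size + 1

/-- Programs; each denotes a partial function from trees to trees, with a running time. -/
inductive Prog : Type
  | id : Prog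
  | nil : Prog
  | fst : Prog
  | snd : Prog
  | pair : Prog → Prog → Prog
  | comp : Prog → Prog → Prog
  | branch : Prog → Prog → Prog → Prog
  | loop : Prog → Prog → Prog

/-- `Prog.Runs p x y t`: on input `x` the program `p` halts with output `y` after time `t`.
As a truth value, `nil` means false and every other tree means true. -/
inductive Prog.Runs : Prog → BTree → BTree → ℕ → Prop
  | id (x : BTree) : Runs .id x x (x.size + 1)
  | nil (x : BTree) : Runs .nil x .nil (x.size + 1)
  | fst_nil : Runs .fst .nil .nil (BTree.nil.size + 1)
  | fst_cons (a b : BTree) : Runs .fst (.cons a b) a ((BTree.cons a b).size + 1)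
  | snd_nil : Runs .snd .nil .nil (BTree.nil.size + 1)
  | snd_cons (a b : BTree) : Runs .snd (.cons a b) b ((BTree.cons a b).size + 1)
  | pair {p q : Prog} {x y z : BTree} {s t : ℕ} :
      Runs p x y s → Runs q x z t → Runs (.pair p q) x (.cons y z) (s + t + x.size + 1)
  -- first `q`, then `p`
  | comp {p q : Prog} {x y z : BTree} {s t : ℕ} :
      Runs q x y s → Runs p y z t → Runs (.comp p q) x z (s + t + 1)
  -- `branch c p q`: if `c` then `p` else `q`
  | branch_true {c p q : Prog} {x a b y : BTree} {s t : ℕ} :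
      Runs c x (.cons a b) s → Runs p x y t → Runs (.branch c p q) x y (s + t + x.size + 1)
  | branch_false {c p q : Prog} {x y : BTree} {s t : ℕ} :
      Runs c x .nil s → Runs q x y t → Runs (.branch c p q) x y (s + t + x.size + 1)
  -- `loop c p`: while `c` do `p`
  | loop_true {c p : Prog} {x a b y z : BTree} {s t u : ℕ} :
      Runs c x (.cons a b) s → Runs p x y t → Runs (.loop c p) y z u →
      Runs (.loop c p) x z (s + t + u + x.size + 1)
  | loop_false {c p : Prog} {x : BTree} {s : ℕ} :
      Runs c x .nil s → Runs (.loop c p) x x (s + x.size + 1)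

/-! ### Encodings -/

/-- The tree of a truth value. -/
def encBool : Bool → BTree
  | false => .nil
  | true => .cons .nil .nil

/-- The tree of a list. -/
def encList {α : Type} (e : α → BTree) : List α → BTree
  | [] => .nil
  | a :: l => .cons (e a) (encList e l)

/-- The tree of a natural number: its binary digits, the least significant one first. -/
def encNat (n : ℕ) : BTree := encList encBool n.bits

/-- The truth table of a Boolean function, as a complete binary tree of depth `a`. -/
def encTable : (a : ℕ) → ((Fin a → Bool) → Bool) → BTree
  | 0, f => encBool (f Fin.elim0)
  | a + 1, f => .cons (encTable a fun v => f (Fin.cons false v))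
      (encTable a fun v => f (Fin.cons true v))

theorem encBool_injective : Function.Injective encBool := by
  intro a b h
  cases a <;> cases b <;> simp_all [encBool]

theorem encList_injective {α : Type} {e : α → BTree} (he : Function.Injective e) :
    Function.Injective (encList e) := by
  intro l
  induction l with
  | nil => intro l' h; cases l' <;> simp_all [encList]
  | cons a l ih =>
    intro l' h
    cases l' with
    | nil => simp [encList] at h
    | cons b l' =>
      simp only [encList, BTree.cons.injEq] at h
      rw [he h.1, ih h.2]

theorem encNat_injective : Function.Injective encNat := by
  intro m n h
  have h' := encList_injective encBool_injective h
  apply Nat.eq_of_testBit_eq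
  intro i
  rw [Nat.testBit_eq_inth, Nat.testBit_eq_inth, h']

theorem encTable_injective (a : ℕ) : Function.Injective (encTable a) := by
  induction a with
  | zero =>
    intro f g h
    funext v
    rw [Subsingleton.elim v Fin.elim0]
    exact encBool_injective h
  | succ a ih =>
    intro f g h
    simp only [encTable, BTree.cons.injEq] at h
    funext v
    rw [← Fin.cons_self_tail v]
    cases v 0
    · exact congrFun (ih h.1) (Fin.tail v)
    · exact congrFun (ih h.2) (Fin.tail v)

/-! ### Parameterized problems and bikernelizations -/

/-- A parameterized problem: its instances, written as trees, and its yes-instances `(x, k)`,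
with parameter `k`. -/
structure ParamProblem where
  Inst : Type
  enc : Inst → BTree
  enc_injective : Function.Injective enc
  Yes : Inst → ℕ → Prop

/-- The input that a program gets for `(x, k)`; the parameter is written in binary. -/
def ParamProblem.code (L : ParamProblem) (x : L.Inst) (k : ℕ) : BTree :=
  .cons (L.enc x) (encNat k)

/-- `F` is a bikernelization from `L` to `L'`: it is computable in polynomial time, it preserves
the answer, and the new parameter and the size of the new instance are bounded by functions of the
old parameter. -/
def IsBikernelization (L L' : ParamProblem) (F : L.Inst → ℕ → L'.Inst × ℕ) : Prop :=
  (∃ (p : Prog) (P : Polynomial ℕ), ∀ x k, ∃ t ≤ P.eval (L.code x k).size,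
    p.Runs (L.code x k) (L'.code (F x k).1 (F x k).2) t) ∧
  (∀ x k, L.Yes x k ↔ L'.Yes (F x k).1 (F x k).2) ∧
  (∃ f : ℕ → ℕ, ∀ x k, (F x k).2 ≤ f k) ∧
  (∃ g : ℕ → ℕ, ∀ x k, (L'.enc (F x k).1).size ≤ g k)

/-! ### Max `r`-CSP -/

/-- A Boolean function, given by its truth table, acting on a list of at most `r` distinct ones of
`n` Boolean variables. -/
structure Constraint (r n : ℕ) where
  vars : List (Fin n)
  nodup : vars.Nodup
  length_le : vars.length ≤ r
  table : (Fin vars.length → Bool) → Bool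

/-- The value of the function at a truth assignment to all `n` variables. -/
def Constraint.eval {r n : ℕ} (c : Constraint r n) (x : Fin n → Bool) : Bool :=
  c.table fun j => x (c.vars.get j)

def Constraint.enc {r n : ℕ} (c : Constraint r n) : BTree :=
  .cons (encList (fun i : Fin n => encNat i) c.vars) (encTable c.vars.length c.table)

/-- An instance of Max `r`-CSP: a collection (repetitions allowed) of Boolean functions of at most
`r` variables each. -/
structure CSP (r : ℕ) where
  numVars : ℕ
  constraints : List (Constraint r numVars)

/-- The number `m` of functions. -/
def CSP.numConstraints {r : ℕ} (I : CSP r) : ℕ := I.constraints.length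

/-- The number of functions that the assignment satisfies. -/
def CSP.numSat {r : ℕ} (I : CSP r) (x : Fin I.numVars → Bool) : ℕ :=
  I.constraints.countP fun c => c.eval x

/-- The average number of satisfied functions over all truth assignments. -/
def CSP.average {r : ℕ} (I : CSP r) : ℚ :=
  (∑ x : Fin I.numVars → Bool, (I.numSat x : ℚ)) / 2 ^ I.numVars

/-- Every one of the variables occurs in some function. -/
def CSP.AllVarsOccur {r : ℕ} (I : CSP r) : Prop :=
  ∀ i : Fin I.numVars, ∃ c ∈ I.constraints, i ∈ c.vars

def CSP.enc {r : ℕ} (I : CSP r) : BTree :=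
  .cons (encNat I.numVars) (encList Constraint.enc I.constraints)

theorem encFin_injective (n : ℕ) : Function.Injective fun i : Fin n => encNat i :=
  encNat_injective.comp Fin.val_injective

theorem Constraint.enc_injective (r n : ℕ) :
    Function.Injective (Constraint.enc : Constraint r n → BTree) := by
  rintro ⟨v, h₁, h₂, f⟩ ⟨w, h₃, h₄, g⟩ h
  simp only [Constraint.enc, BTree.cons.injEq] at h
  obtain rfl := encList_injective (encFin_injective n) h.1
  obtain rfl := encTable_injective _ h.2
  rfl

theorem CSP.enc_injective (r : ℕ) : Function.Injective (CSP.enc : CSP r → BTree) := by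
  rintro ⟨n, l⟩ ⟨n', l'⟩ h
  simp only [CSP.enc, BTree.cons.injEq] at h
  obtain rfl := encNat_injective h.1
  obtain rfl := encList_injective (Constraint.enc_injective r n) h.2
  rfl

/-- Max `r`-CSP above average: can at least `E + k * 2 ^ (-r)` functions be satisfied, where `E` is
the average number of satisfied functions? -/
def MaxCSP (r : ℕ) : ParamProblem where
  Inst := CSP r
  enc := CSP.enc
  enc_injective := CSP.enc_injective r
  Yes I k := ∃ x : Fin I.numVars → Bool, I.average + (k : ℚ) / 2 ^ r ≤ I.numSat x

/-! ### Max `r`-Lin AA -/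

/-- An equation `∑ i ∈ vars, z i = rhs` over `𝔽₂` with at most `r` of `n` variables and with a
positive integral weight. -/
structure LinEquation (r n : ℕ) where
  vars : List (Fin n)
  nodup : vars.Nodup
  length_le : vars.length ≤ r
  rhs : ZMod 2
  weight : ℕ
  weight_pos : 0 < weight

def LinEquation.Satisfied {r n : ℕ} (e : LinEquation r n) (z : Fin n → ZMod 2) : Prop :=
  (e.vars.map z).sum = e.rhs

instance LinEquation.decidableSatisfied {r n : ℕ} (e : LinEquation r n) (z : Fin n → ZMod 2) :
    Decidable (e.Satisfied z) :=
  inferInstanceAs (Decidable ((e.vars.map z).sum = e.rhs))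

def LinEquation.enc {r n : ℕ} (e : LinEquation r n) : BTree :=
  .cons (encList (fun i : Fin n => encNat i) e.vars) (.cons (encNat e.rhs.val) (encNat e.weight))

/-- A weighted system of linear equations over `𝔽₂` with at most `r` variables per equation. -/
structure LinSystem (r : ℕ) where
  numVars : ℕ
  equations : List (LinEquation r numVars)

/-- The excess of an assignment: the total weight of the satisfied equations minus the total weight
of the falsified ones. -/
def LinSystem.excess {r : ℕ} (S : LinSystem r) (z : Fin S.numVars → ZMod 2) : ℤ :=
  (S.equations.map fun e => if e.Satisfied z then (e.weight : ℤ) else -(e.weight : ℤ)).sum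

def LinSystem.enc {r : ℕ} (S : LinSystem r) : BTree :=
  .cons (encNat S.numVars) (encList LinEquation.enc S.equations)

theorem LinEquation.enc_injective (r n : ℕ) :
    Function.Injective (LinEquation.enc : LinEquation r n → BTree) := by
  rintro ⟨v, h₁, h₂, b, w, hw⟩ ⟨v', h₃, h₄, b', w', hw'⟩ h
  simp only [LinEquation.enc, BTree.cons.injEq] at h
  obtain rfl := encList_injective (encFin_injective n) h.1
  obtain rfl := ZMod.val_injective 2 (encNat_injective h.2.1)
  obtain rfl := encNat_injective h.2.2
  rfl

theorem LinSystem.enc_injective (r : ℕ) :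
    Function.Injective (LinSystem.enc : LinSystem r → BTree) := by
  rintro ⟨n, l⟩ ⟨n', l'⟩ h
  simp only [LinSystem.enc, BTree.cons.injEq] at h
  obtain rfl := encNat_injective h.1
  obtain rfl := encList_injective (LinEquation.enc_injective r n) h.2
  rfl

/-- Max `r`-Lin AA: is the maximum excess at least `k`? -/
def MaxLinAA (r : ℕ) : ParamProblem where
  Inst := LinSystem r
  enc := LinSystem.enc
  enc_injective := LinSystem.enc_injective r
  Yes S k := ∃ z : Fin S.numVars → ZMod 2, (k : ℤ) ≤ S.excess z

/-- `g(k) = O(k log k)`. -/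
def IsBigOKLogK (g : ℕ → ℕ) : Prop :=
  (fun k => (g k : ℝ)) =O[atTop] fun k : ℕ => (k : ℝ) * Real.log k

/-! Multiply everything by `2 ^ r` and expand each Boolean function into signed products of the
signs `(-1) ^ x v`. Nonconstant products average to zero, so the question becomes whether the sum of
the nonconstant ones can reach `k`. Collecting products with the same variables and cancelling
opposite signs leaves an integral combination of distinct nontrivial characters of weight at most
`r`, which is the excess of a system in which no left-hand side is repeated (`CSP.yes_iff_system`).

Call a set `K` of characters with nonzero coefficients sum-free if no sum of two or more of its
members is zero or has a nonzero coefficient. Weighting the assignments by the Riesz product of the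
factors `1 + sign (w s) * chi s` over `K` makes the mean of the combination equal to the sum of `|w
s|` over `K` (`exists_sum_abs_le`). There are two consequences. A singleton is sum-free, so one
weight of at least `k` forces the answer yes. Moreover, if all `n` variables occur, some sum of the
characters present is nonzero in at least `n / 2` coordinates; a smallest set with that sum is
sum-free and has at least `n / (2 * r)` members, so `n > 2 * r * k` also forces yes
(`exists_le_of_lt_card`).

In these two cases the kernel is a trivial yes-instance. Otherwise at most `2 * r * k` variables
remain, all weights are below `k`, and there are at most `2 ^ n` distinct left-hand sides, so the
system itself is the kernel. The number of variables is even linear in `k`. Trying all assignments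
takes time polynomial in `|x| + 2 ^ (2 * r * k)`, which splits into a polynomial in `|x|` plus `2 ^
O(k)`.

The programs are assembled from closure properties of `PolyTime`. Weights are held in unary, as
lengths of lists, which is affordable because `r` is fixed; `k` stays in binary. -/

/-! ### Polynomial time functions between encoded types -/

/-- Types whose elements are written as trees. -/
class TreeEnc (α : Type) where
  enc : α → BTree

open TreeEnc

instance : TreeEnc BTree := ⟨fun t => t⟩
instance : TreeEnc Bool := ⟨encBool⟩
instance : TreeEnc ℕ := ⟨encNat⟩
instance {α : Type} [TreeEnc α] : TreeEnc (List α) := ⟨encList enc⟩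
instance {α β : Type} [TreeEnc α] [TreeEnc β] : TreeEnc (α × β) :=
  ⟨fun p => .cons (enc p.1) (enc p.2)⟩

/-- The size of the tree of an element. -/
def tsize {α : Type} [TreeEnc α] (a : α) : ℕ := (enc a).size

/-- The function is computed by a program in polynomial time. -/
def PolyTime {α β : Type} [TreeEnc α] [TreeEnc β] (f : α → β) : Prop :=
  ∃ (p : Prog) (P : Polynomial ℕ), ∀ a, ∃ t ≤ P.eval (tsize a), p.Runs (enc a) (enc (f a)) t

theorem eval_le_eval (P : Polynomial ℕ) {m n : ℕ} (h : m ≤ n) : P.eval m ≤ P.eval n := by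
  simp only [Polynomial.eval_eq_sum, Polynomial.sum]
  exact Finset.sum_le_sum fun i _ => Nat.mul_le_mul_left _ (Nat.pow_le_pow_left h i)

theorem BTree.size_pos (x : BTree) : 0 < x.size := by
  cases x <;> simp [BTree.size]

/-- Every operation is charged for the value it handles, so time dominates size. This is what makes
polynomial time closed under composition: the second program receives an input of polynomial size.
-/
theorem Prog.Runs.size_le {p : Prog} {x y : BTree} {t : ℕ} (h : p.Runs x y t) :
    x.size ≤ t ∧ y.size ≤ t := by
  induction h <;> (try simp only [BTree.size] at *) <;> omega

section
variable {α β γ δ σ τ : Type} [TreeEnc α] [TreeEnc β] [TreeEnc γ] [TreeEnc δ] [TreeEnc σ] [TreeEnc τ]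

theorem tsize_pair (a : α) (b : β) : tsize (a, b) = tsize a + tsize b + 1 := rfl
theorem tsize_nil : tsize ([] : List α) = 1 := rfl
theorem tsize_cons (a : α) (l : List α) : tsize (a :: l) = tsize a + tsize l + 1 := rfl
theorem tsize_pos (a : α) : 0 < tsize a := BTree.size_pos _
theorem tsize_bool (b : Bool) : tsize b ≤ 3 := by
  cases b <;> simp [tsize, enc, encBool, BTree.size]

theorem length_lt_tsize (l : List α) : l.length < tsize l := by
  induction l with
  | nil => simp [tsize_nil]
  | cons a l ih => rw [tsize_cons, List.length_cons]; omega

theorem tsize_le_of_mem {a : α} {l : List α} (h : a ∈ l) : tsize a ≤ tsize l := by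
  induction l with
  | nil => simp at h
  | cons b l ih =>
    rw [tsize_cons]
    rcases List.mem_cons.1 h with rfl | h
    · omega
    · have := ih h; omega

theorem tsize_append (l l' : List α) : tsize (l ++ l') + 1 = tsize l + tsize l' := by
  induction l with
  | nil => rw [List.nil_append, tsize_nil]; omega
  | cons a l ih => rw [List.cons_append, tsize_cons, tsize_cons]; omega

theorem tsize_le_of_sublist {l l' : List α} (h : l.Sublist l') : tsize l ≤ tsize l' := by
  induction h with
  | slnil => rfl
  | cons a _ ih => rw [tsize_cons]; omega
  | cons_cons a _ ih => rw [tsize_cons, tsize_cons]; omega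

namespace PolyTime

theorem tsize_le {f : α → β} (hf : PolyTime f) :
    ∃ P : Polynomial ℕ, ∀ a, tsize (f a) ≤ P.eval (tsize a) := by
  obtain ⟨p, P, h⟩ := hf
  refine ⟨P, fun a => ?_⟩
  obtain ⟨t, ht, hr⟩ := h a
  exact hr.size_le.2.trans ht

/-- Functions with the same trees as input and output are computed by the same program. -/
theorem of_enc_eq {f : α → β} (hf : PolyTime f) {g : γ → δ} (i : γ → α)
    (hi : ∀ c, enc c = enc (i c)) (hg : ∀ c, enc (g c) = enc (f (i c))) : PolyTime g := by
  obtain ⟨p, P, h⟩ := hf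
  refine ⟨p, P, fun c => ?_⟩
  rw [tsize, hi, hg]
  exact h (i c)

theorem id : PolyTime fun a : α => a :=
  ⟨.id, .X + 1, fun a => ⟨_, by simp [tsize], .id _⟩⟩

theorem comp {g : β → γ} {f : α → β} (hg : PolyTime g) (hf : PolyTime f) :
    PolyTime fun a => g (f a) := by
  obtain ⟨p, P, hp⟩ := hf
  obtain ⟨q, Q, hq⟩ := hg
  refine ⟨.comp q p, P + Q.comp P + 1, fun a => ?_⟩
  obtain ⟨s, hs, h⟩ := hp a
  obtain ⟨t, ht, h'⟩ := hq (f a)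
  refine ⟨_, ?_, .comp h h'⟩
  have := eval_le_eval Q (h.size_le.2.trans hs)
  simp only [Polynomial.eval_add, Polynomial.eval_comp, Polynomial.eval_one]
  exact Nat.add_le_add_right (Nat.add_le_add hs (ht.trans this)) 1

theorem pair {f : α → β} {g : α → γ} (hf : PolyTime f) (hg : PolyTime g) :
    PolyTime fun a => (f a, g a) := by
  obtain ⟨p, P, hp⟩ := hf
  obtain ⟨q, Q, hq⟩ := hg
  refine ⟨.pair p q, P + Q + .X + 1, fun a => ?_⟩
  obtain ⟨s, hs, h⟩ := hp a
  obtain ⟨t, ht, h'⟩ := hq a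
  refine ⟨_, ?_, .pair h h'⟩
  simp only [Polynomial.eval_add, Polynomial.eval_X, Polynomial.eval_one, tsize] at *
  omega

theorem fst : PolyTime fun p : α × β => p.1 :=
  ⟨.fst, .X + 1, fun p => ⟨_, by simp [tsize, enc], .fst_cons (enc p.1) (enc p.2)⟩⟩

theorem snd : PolyTime fun p : α × β => p.2 :=
  ⟨.snd, .X + 1, fun p => ⟨_, by simp [tsize, enc], .snd_cons (enc p.1) (enc p.2)⟩⟩

theorem const (b : β) : PolyTime fun _ : α => b := by
  suffices h : ∀ y : BTree, ∃ (p : Prog) (P : Polynomial ℕ), ∀ x : BTree,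
      ∃ t ≤ P.eval x.size, p.Runs x y t by
    obtain ⟨p, P, h⟩ := h (enc b)
    exact ⟨p, P, fun a => h (enc a)⟩
  intro y
  induction y with
  | nil => exact ⟨.nil, .X + 1, fun x => ⟨_, by simp, .nil x⟩⟩
  | cons y z hy hz =>
    obtain ⟨p, P, hp⟩ := hy
    obtain ⟨q, Q, hq⟩ := hz
    refine ⟨.pair p q, P + Q + .X + 1, fun x => ?_⟩
    obtain ⟨s, hs, h⟩ := hp x
    obtain ⟨t, ht, h'⟩ := hq x
    refine ⟨_, ?_, .pair h h'⟩
    simp only [Polynomial.eval_add, Polynomial.eval_X, Polynomial.eval_one]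
    omega

theorem ite {c : α → Bool} {f g : α → β} (hc : PolyTime c) (hf : PolyTime f) (hg : PolyTime g) :
    PolyTime fun a => if c a then f a else g a := by
  obtain ⟨o, O, ho⟩ := hc
  obtain ⟨p, P, hp⟩ := hf
  obtain ⟨q, Q, hq⟩ := hg
  refine ⟨.branch o p q, O + P + Q + .X + 1, fun a => ?_⟩
  obtain ⟨u, hu, h₀⟩ := ho a
  obtain ⟨s, hs, h⟩ := hp a
  obtain ⟨t, ht, h'⟩ := hq a
  simp only [Polynomial.eval_add, Polynomial.eval_X, Polynomial.eval_one]
  cases hca : c a with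
  | true =>
    rw [hca] at h₀
    exact ⟨_, by simp only [tsize] at *; omega, .branch_true h₀ h⟩
  | false =>
    rw [hca] at h₀
    exact ⟨_, by simp only [tsize] at *; omega, .branch_false h₀ h'⟩

theorem cons {f : α → β} {g : α → List β} (hf : PolyTime f) (hg : PolyTime g) :
    PolyTime fun a => f a :: g a :=
  (hf.pair hg).of_enc_eq (fun a => a) (fun _ => rfl) fun _ => rfl

/-- The tree of a list is `nil` exactly when the list is empty, so `branch` can test it directly. A
nonempty list and the pair of its head and tail have the same tree, so no unpacking is needed. -/
theorem listCases {l : α → List τ} {f : α → β} {g : α → τ → List τ → β} (hl : PolyTime l)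
    (hf : PolyTime f) (hg : PolyTime fun p : α × τ × List τ => g p.1 p.2.1 p.2.2) :
    PolyTime fun a => match l a with | [] => f a | x :: xs => g a x xs := by
  obtain ⟨o, O, ho⟩ := hl
  obtain ⟨p, P, hp⟩ := hf
  obtain ⟨q, Q, hq⟩ := hg
  refine ⟨.branch o (.comp q (.pair .id o)) p,
    2 * O + P + Q.comp (.X + O + 1) + 3 * .X + 4, fun a => ?_⟩
  obtain ⟨u, hu, h₀⟩ := ho a
  simp only [Polynomial.eval_add, Polynomial.eval_X, Polynomial.eval_one, Polynomial.eval_mul,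
    Polynomial.eval_comp, Polynomial.eval_ofNat]
  cases hla : l a with
  | nil =>
    obtain ⟨s, hs, h⟩ := hp a
    rw [hla] at h₀
    exact ⟨_, by simp only [tsize] at *; omega, .branch_false h₀ h⟩
  | cons x xs =>
    obtain ⟨t, ht, h'⟩ := hq (a, x, xs)
    rw [hla] at h₀
    have h₁ : (enc (x :: xs)).size ≤ u := h₀.size_le.2
    have h₂ : tsize (a, x, xs) ≤ tsize a + O.eval (tsize a) + 1 := by
      have : tsize (a, x, xs) = tsize a + (enc (x :: xs)).size + 1 := rfl
      omega
    have h₃ := eval_le_eval Q h₂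
    refine ⟨_, ?_, .branch_true h₀ (.comp (.pair (.id _) h₀) h')⟩
    simp only [tsize] at *
    omega

/-- Loops over a list: the running time is polynomial in the size of the data and a bound on the
sizes of the intermediate states. -/
theorem foldl_runs {f : α → σ → τ → σ} (hf : PolyTime fun p : α × σ × τ => f p.1 p.2.1 p.2.2) :
    ∃ (p : Prog) (P : Polynomial ℕ), ∀ a s l B,
      (∀ l', l' <+: l → tsize (l'.foldl (f a) s) ≤ B) →
      ∃ t ≤ P.eval (tsize a + tsize l + B),
        p.Runs (enc (a, s, l)) (enc (l.foldl (f a) s)) t := by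
  have hc : PolyTime fun p : α × σ × List τ => p.2.2 := snd.comp snd
  have hb : PolyTime fun p : α × σ × τ × List τ => (p.1, f p.1 p.2.1 p.2.2.1, p.2.2.2) :=
    fst.pair ((hf.comp (fst.pair ((fst.comp snd).pair (fst.comp (snd.comp snd))))).pair
      (snd.comp (snd.comp snd)))
  have hx : PolyTime fun p : α × σ × List τ => p.2.1 := fst.comp snd
  obtain ⟨c, C, hc⟩ := hc
  obtain ⟨b, D, hb⟩ := hb
  obtain ⟨x, E, hx⟩ := hx
  -- `N` bounds the tree of every loop state (data, accumulator, remaining list), so all rounds obey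
  -- the same time bound.
  have loop : ∀ (N : ℕ) (a : α) (l : List τ) (s : σ),
      (∀ l', l' <+: l → tsize a + tsize l + tsize (l'.foldl (f a) s) + 2 ≤ N) →
      ∃ t ≤ (l.length + 1) * (C.eval N + D.eval N + N + 1),
        (Prog.loop c b).Runs (enc (a, s, l)) (enc (a, l.foldl (f a) s, ([] : List τ))) t := by
    intro N a l
    induction l with
    | nil =>
      intro s h
      obtain ⟨u, hu, h₀⟩ := hc (a, s, [])
      have h₁ : tsize (a, s, ([] : List τ)) ≤ N := by
        have := h [] List.prefix_rfl
        simp only [List.foldl_nil, tsize_pair] at *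
        omega
      have h₂ := eval_le_eval C h₁
      refine ⟨_, ?_, .loop_false h₀⟩
      simp only [tsize] at *
      simp only [List.length_nil, zero_add, one_mul]
      omega
    | cons y l ih =>
      intro s h
      obtain ⟨u, hu, h₀⟩ := hc (a, s, y :: l)
      obtain ⟨v, hv, h'⟩ := hb (a, s, y, l)
      obtain ⟨w, hw, h''⟩ := ih (f a s y) fun l' hl' => by
        have := h (y :: l') ((List.prefix_cons_inj y).2 hl')
        rw [List.foldl_cons, tsize_cons] at this
        omega
      have h₁ : tsize (a, s, y :: l) ≤ N := by
        have := h [] List.nil_prefix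
        simp only [List.foldl_nil, tsize_pair] at *
        omega
      have h₂ := eval_le_eval C h₁
      have h₃ := eval_le_eval D h₁
      refine ⟨_, ?_, .loop_true h₀ h' h''⟩
      have h₄ : tsize (a, s, y, l) = tsize (a, s, y :: l) := rfl
      rw [h₄] at hv
      simp only [List.length_cons, Nat.succ_mul] at *
      simp only [tsize] at *
      omega
  refine ⟨.comp x (.loop c b),
    (.X + 1) * (C.comp (.X + 2) + D.comp (.X + 2) + .X + 3) + E.comp (.X + 2) + 1,
    fun a s l B h => ?_⟩
  obtain ⟨t, ht, h₁⟩ := loop (tsize a + tsize l + B + 2) a l s fun l' hl' => by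
    have := h l' hl'
    omega
  obtain ⟨u, hu, h₂⟩ := hx (a, l.foldl (f a) s, [])
  have h₃ : tsize (a, l.foldl (f a) s, ([] : List τ)) ≤ tsize a + tsize l + B + 2 := by
    have := h l List.prefix_rfl
    have := tsize_pos l
    simp only [tsize_pair, tsize_nil]
    omega
  have h₄ := eval_le_eval E h₃
  refine ⟨_, ?_, .comp h₁ h₂⟩
  simp only [Polynomial.eval_add, Polynomial.eval_X, Polynomial.eval_one, Polynomial.eval_mul,
    Polynomial.eval_comp, Polynomial.eval_ofNat]
  have h₅ : l.length + 1 ≤ tsize a + tsize l + B + 1 := by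
    have := length_lt_tsize l
    omega
  have h₆ := Nat.mul_le_mul_right (C.eval (tsize a + tsize l + B + 2) +
    D.eval (tsize a + tsize l + B + 2) + (tsize a + tsize l + B + 2) + 1) h₅
  have h₇ : ∀ z, z + (tsize a + tsize l + B + 2) + 1 = z + (tsize a + tsize l + B) + 3 := by
    intro z; omega
  rw [h₇] at h₆ ht
  omega

/-- A polynomial time body does not suffice, since a state that doubles in each round grows
exponentially. Hence the bound on the state after every prefix of the list. -/
theorem foldl_of_bounded {l : α → List τ} {i : α → σ} {f : α → σ → τ → σ} (hl : PolyTime l)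
    (hi : PolyTime i) (hf : PolyTime fun p : α × σ × τ => f p.1 p.2.1 p.2.2)
    (hB : ∃ B : Polynomial ℕ, ∀ a l', l' <+: l a →
      tsize (l'.foldl (f a) (i a)) ≤ B.eval (tsize a)) :
    PolyTime fun a => (l a).foldl (f a) (i a) := by
  obtain ⟨p, P, hp⟩ := foldl_runs hf
  obtain ⟨q, Q, hq⟩ := (id (α := α)).pair (hi.pair hl)
  obtain ⟨R, hR⟩ := hl.tsize_le
  obtain ⟨B, hB⟩ := hB
  refine ⟨.comp p q, Q + P.comp (.X + R + B) + 1, fun a => ?_⟩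
  obtain ⟨s, hs, h⟩ := hq a
  obtain ⟨t, ht, h'⟩ := hp a (i a) (l a) _ (hB a)
  refine ⟨_, ?_, .comp h h'⟩
  have := eval_le_eval P (show tsize a + tsize (l a) + B.eval (tsize a) ≤
    tsize a + R.eval (tsize a) + B.eval (tsize a) by have := hR a; omega)
  simp only [Polynomial.eval_add, Polynomial.eval_comp, Polynomial.eval_one, Polynomial.eval_X]
  omega

/-- Loops over a list whose state grows by a bounded amount in each round. -/
theorem foldl {l : α → List τ} {i : α → σ} {f : α → σ → τ → σ} (hl : PolyTime l)
    (hi : PolyTime i) (hf : PolyTime fun p : α × σ × τ => f p.1 p.2.1 p.2.2)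
    (hG : ∃ G : Polynomial ℕ, ∀ a s x, tsize (f a s x) ≤ tsize s + G.eval (tsize (a, x))) :
    PolyTime fun a => (l a).foldl (f a) (i a) := by
  obtain ⟨G, hG⟩ := hG
  obtain ⟨I, hI⟩ := hi.tsize_le
  obtain ⟨R, hR⟩ := hl.tsize_le
  refine foldl_of_bounded hl hi hf ⟨I + R * G.comp (.X + R + 1), fun a l' hl' => ?_⟩
  have key : ∀ (l' : List τ) (s : σ), (∀ x ∈ l', x ∈ l a) →
      tsize (l'.foldl (f a) s) ≤ tsize s + l'.length * G.eval (tsize a + R.eval (tsize a) + 1) := by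
    intro l'
    induction l' with
    | nil => intro s _; simp
    | cons x l' ih =>
      intro s h
      have h₁ := ih (f a s x) fun y hy => h y (List.mem_cons_of_mem _ hy)
      have h₂ := hG a s x
      have h₃ := tsize_le_of_mem (h x List.mem_cons_self)
      have h₄ := eval_le_eval G (show tsize (a, x) ≤ tsize a + R.eval (tsize a) + 1 by
        have := hR a; rw [tsize_pair]; omega)
      rw [List.foldl_cons, List.length_cons, Nat.succ_mul]
      omega
  have h₁ := key l' (i a) fun x hx => hl'.subset hx
  have h₂ : l'.length ≤ R.eval (tsize a) :=
    hl'.length_le.trans ((length_lt_tsize _).le.trans (hR a))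
  have h₃ := hI a
  simp only [Polynomial.eval_add, Polynomial.eval_mul, Polynomial.eval_comp, Polynomial.eval_one,
    Polynomial.eval_X]
  have := Nat.mul_le_mul_right (G.eval (tsize a + R.eval (tsize a) + 1)) h₂
  omega

end PolyTime
end

/-! ### Operations on truth values, lists and numbers -/

/-- Equality can be decided in polynomial time. -/
def PolyEq (α : Type) [TreeEnc α] [DecidableEq α] : Prop :=
  PolyTime fun p : α × α => decide (p.1 = p.2)

/-- The digits of `n + 1`, in terms of those of `n`. -/
def incBits : List Bool → List Bool
  | [] => [true]
  | false :: l => true :: l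
  | true :: l => false :: incBits l

theorem bits_succ (n : ℕ) : (n + 1).bits = incBits n.bits := by
  induction n using Nat.strong_induction_on with
  | _ n ih =>
    obtain ⟨m, rfl | rfl⟩ := Nat.even_or_odd' n
    · rcases Nat.eq_zero_or_pos m with rfl | hm
      · simp [incBits]
      · rw [Nat.bit1_bits, Nat.bit0_bits m hm.ne', incBits]
    · rw [show 2 * m + 1 + 1 = 2 * (m + 1) by ring, Nat.bit0_bits _ (by omega), Nat.bit1_bits,
        incBits, ih m (by omega)]

section
variable {α β γ δ σ τ : Type} [TreeEnc α] [TreeEnc β] [TreeEnc γ] [TreeEnc δ] [TreeEnc σ] [TreeEnc τ]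

theorem tsize_succ (n : ℕ) : tsize (n + 1) ≤ tsize n + 4 := by
  have key : ∀ l : List Bool, tsize (incBits l) ≤ tsize l + 4 := by
    intro l
    induction l with
    | nil => simp [incBits, tsize, enc, encList, encBool, BTree.size]
    | cons b l ih =>
      have h₁ : tsize false = 1 := rfl
      have h₂ : tsize true = 3 := rfl
      cases b <;> simp only [incBits, tsize_cons] <;> omega
  have h := key n.bits
  rw [← bits_succ] at h
  exact h

theorem tsize_nat_le (n : ℕ) : tsize n ≤ 4 * n + 1 := by
  induction n with
  | zero => simp [tsize, enc, encNat, encList, BTree.size]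
  | succ n ih => have := tsize_succ n; omega

namespace PolyTime

theorem of_eq {f g : α → β} (hf : PolyTime f) (h : ∀ a, f a = g a) : PolyTime g := by
  rwa [← funext h]

theorem and {f g : α → Bool} (hf : PolyTime f) (hg : PolyTime g) :
    PolyTime fun a => f a && g a :=
  (hf.ite hg (const false)).of_eq fun a => by cases f a <;> simp

theorem or {f g : α → Bool} (hf : PolyTime f) (hg : PolyTime g) :
    PolyTime fun a => f a || g a :=
  (hf.ite (const true) hg).of_eq fun a => by cases f a <;> simp

theorem not {f : α → Bool} (hf : PolyTime f) : PolyTime fun a => !f a :=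
  (hf.ite (const false) (const true)).of_eq fun a => by cases f a <;> simp

theorem xor {f g : α → Bool} (hf : PolyTime f) (hg : PolyTime g) :
    PolyTime fun a => f a ^^ g a :=
  (hf.ite hg.not hg).of_eq fun a => by cases f a <;> simp

theorem reverse {l : α → List τ} (hl : PolyTime l) : PolyTime fun a => (l a).reverse :=
  (hl.foldl (f := fun _ s x => x :: s) (const []) ((snd.comp snd).cons (fst.comp snd))
    ⟨.X, fun a s x => by simp only [tsize_cons, tsize_pair, Polynomial.eval_X]; omega⟩).of_eq
      fun a => by simp

theorem append {l l' : α → List τ} (hl : PolyTime l) (hl' : PolyTime l') :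
    PolyTime fun a => l a ++ l' a :=
  (hl.reverse.foldl (f := fun _ s x => x :: s) hl' ((snd.comp snd).cons (fst.comp snd))
    ⟨.X, fun a s x => by simp only [tsize_cons, tsize_pair, Polynomial.eval_X]; omega⟩).of_eq
      fun a => by simp

theorem flatMap {l : α → List τ} {f : α → τ → List β} (hl : PolyTime l)
    (hf : PolyTime fun p : α × τ => f p.1 p.2) : PolyTime fun a => (l a).flatMap (f a) := by
  obtain ⟨G, hG⟩ := hf.tsize_le
  refine (hl.foldl (f := fun a s x => s ++ f a x) (const [])
    ((fst.comp snd).append (hf.comp (fst.pair (snd.comp snd))))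
    ⟨G, fun a s x => ?_⟩).of_eq fun a => by rw [List.flatMap_eq_foldl]
  have := hG (a, x)
  have := tsize_append s (f a x)
  simp only at *
  omega

theorem map {l : α → List τ} {f : α → τ → β} (hl : PolyTime l)
    (hf : PolyTime fun p : α × τ => f p.1 p.2) : PolyTime fun a => (l a).map (f a) :=
  (hl.flatMap (f := fun a x => [f a x]) (hf.cons (const []))).of_eq fun a => by
    induction l a with
    | nil => rfl
    | cons x l ih => simpa using ih

theorem filter {l : α → List τ} {f : α → τ → Bool} (hl : PolyTime l)
    (hf : PolyTime fun p : α × τ => f p.1 p.2) : PolyTime fun a => (l a).filter (f a) :=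
  (hl.flatMap (f := fun a x => if f a x then [x] else [])
    (hf.ite (snd.cons (const [])) (const []))).of_eq fun a => by
      induction l a with
      | nil => rfl
      | cons x l ih => cases h : f a x <;> simp_all

theorem any {l : α → List τ} {f : α → τ → Bool} (hl : PolyTime l)
    (hf : PolyTime fun p : α × τ => f p.1 p.2) : PolyTime fun a => (l a).any (f a) :=
  (hl.foldl (f := fun a s x => s || f a x) (const false)
    ((fst.comp snd).or (hf.comp (fst.pair (snd.comp snd))))
    ⟨3, fun a s x => (tsize_bool _).trans (by simp)⟩).of_eq fun a => by
      suffices h : ∀ (l : List τ) (b : Bool), l.foldl (fun s x => s || f a x) b = (b || l.any (f a)) by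
        simp [h]
      intro l
      induction l with
      | nil => simp
      | cons x l ih => intro b; simp [ih, Bool.or_assoc]

theorem isEmpty {l : α → List τ} (hl : PolyTime l) : PolyTime fun a => (l a).isEmpty :=
  (hl.listCases (g := fun _ _ _ => false) (const true) (const false)).of_eq fun a => by
    cases l a <;> rfl

theorem tail {l : α → List τ} (hl : PolyTime l) : PolyTime fun a => (l a).tail :=
  (hl.listCases (g := fun _ _ xs => xs) (const []) (snd.comp snd)).of_eq fun a => by
    cases l a <;> rfl

/-- On lengths this is truncated subtraction, the only subtraction that weights in unary require. -/
theorem drop_length {l : α → List τ} {l' : α → List β} (hl : PolyTime l) (hl' : PolyTime l') :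
    PolyTime fun a => (l a).drop (l' a).length :=
  (hl'.foldl (f := fun _ s _ => s.tail) hl (fst.comp snd).tail
    ⟨0, fun a s x => by cases s <;> simp [tsize_cons]; omega⟩).of_eq fun a => by
      suffices h : ∀ (l' : List β) (l : List τ),
          l'.foldl (fun s _ => s.tail) l = l.drop l'.length from h _ _
      intro l'
      induction l' with
      | nil => simp
      | cons x l' ih => intro l; simp [ih]

theorem bool_eq {f g : α → Bool} (hf : PolyTime f) (hg : PolyTime g) :
    PolyTime fun a => decide (f a = g a) :=
  (hf.xor hg).not.of_eq fun a => by cases f a <;> cases g a <;> rfl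

end PolyTime

theorem PolyEq.decide_eq [DecidableEq β] (h : PolyEq β) {f g : α → β} (hf : PolyTime f)
    (hg : PolyTime g) : PolyTime fun a => decide (f a = g a) :=
  PolyTime.comp h (hf.pair hg)

theorem PolyEq.bool : PolyEq Bool := PolyTime.fst.bool_eq PolyTime.snd

theorem PolyEq.prod [DecidableEq α] [DecidableEq β] (hα : PolyEq α) (hβ : PolyEq β) :
    PolyEq (α × β) :=
  ((hα.decide_eq (.comp .fst .fst) (.comp .fst .snd)).and
    (hβ.decide_eq (.comp .snd .fst) (.comp .snd .snd))).of_eq fun p => by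
      simp [Prod.ext_iff]

theorem PolyEq.list [DecidableEq α] (hα : PolyEq α) : PolyEq (List α) := by
  -- The state is the verdict so far and the unread part of the second list. The lists are equal if
  -- the verdict is still true and nothing is left unread.
  let step : Bool × List α → α → Bool × List α := fun s x =>
    match s.2 with | [] => (false, []) | y :: ys => (s.1 && decide (x = y), ys)
  have hstep : PolyTime fun p : (List α × List α) × (Bool × List α) × α => step p.2.1 p.2.2 :=
    (PolyTime.snd.comp (PolyTime.fst.comp PolyTime.snd)).listCases (f := fun _ => (false, []))
      (g := fun p y ys => (p.2.1.1 && decide (p.2.2 = y), ys)) (.const _)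
      (((PolyTime.fst.comp (PolyTime.fst.comp (PolyTime.snd.comp PolyTime.fst))).and
        (hα.decide_eq (PolyTime.snd.comp (PolyTime.snd.comp PolyTime.fst))
          (PolyTime.fst.comp PolyTime.snd))).pair (PolyTime.snd.comp PolyTime.snd))
  have hloop : PolyTime fun p : List α × List α => p.1.foldl step (true, p.2) :=
    PolyTime.fst.foldl (f := fun _ => step) ((PolyTime.const true).pair PolyTime.snd) hstep
      ⟨3, fun a s x => by
        rcases s with ⟨b, _ | ⟨y, ys⟩⟩
        · have := tsize_bool false
          simp only [step, tsize_pair, Polynomial.eval_ofNat]; omega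
        · have := tsize_bool (b && decide (x = y))
          simp only [step, tsize_pair, tsize_cons, Polynomial.eval_ofNat]; omega⟩
  refine ((PolyTime.fst.comp hloop).and (PolyTime.snd.comp hloop).isEmpty).of_eq fun p => ?_
  suffices h : ∀ (l l' : List α) (b : Bool),
      ((l.foldl step (b, l')).1 && (l.foldl step (b, l')).2.isEmpty) = (b && decide (l = l')) by
    simpa using h p.1 p.2 true
  intro l
  induction l with
  | nil => intro l' b; cases l' <;> simp
  | cons x l ih =>
    intro l' b
    cases l' with
    | nil => simpa [step] using ih [] false
    | cons y l' => simp [step, ih, Bool.and_assoc]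

theorem PolyEq.nat : PolyEq ℕ :=
  PolyTime.of_enc_eq (PolyEq.list PolyEq.bool) (fun p : ℕ × ℕ => (p.1.bits, p.2.bits))
    (fun _ => rfl) fun p => by
      have : p.1 = p.2 ↔ p.1.bits = p.2.bits :=
        ⟨fun h => by rw [h], fun h => encNat_injective (by rw [encNat, encNat, h])⟩
      simp [this]

namespace PolyTime

theorem mem [DecidableEq β] (h : PolyEq β) {x : α → β} {l : α → List β} (hx : PolyTime x)
    (hl : PolyTime l) : PolyTime fun a => decide (x a ∈ l a) :=
  (hl.any (f := fun a y => decide (x a = y)) (h.decide_eq (hx.comp fst) snd)).of_eq fun a => by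
    rw [Bool.eq_iff_iff]; simp

theorem incBits : PolyTime _root_.incBits := by
  -- The state is the carry and the digits already written, in reverse order.
  let step : Bool × List Bool → Bool → Bool × List Bool := fun s x => (s.1 && x, (s.1 ^^ x) :: s.2)
  have hloop : PolyTime fun l : List Bool => l.foldl step (true, []) :=
    id.foldl (f := fun _ => step) (const _)
      (((fst.comp (fst.comp snd)).and (snd.comp snd)).pair
        (((fst.comp (fst.comp snd)).xor (snd.comp snd)).cons (snd.comp (fst.comp snd))))
      ⟨7, fun a s x => by
        have h₁ := tsize_bool (s.1 && x)
        have h₂ := tsize_bool (s.1 ^^ x)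
        have h₃ := tsize_pos s.1
        rw [← Prod.mk.eta (p := s)]
        simp only [step, tsize_pair, tsize_cons, Polynomial.eval_ofNat] at *; omega⟩
  refine ((fst.comp hloop).ite ((snd.comp hloop).reverse.append (const [true]))
    (snd.comp hloop).reverse).of_eq fun l => ?_
  have h₁ : ∀ (l acc : List Bool), l.foldl step (false, acc) = (false, l.reverse ++ acc) := by
    intro l
    induction l with
    | nil => simp
    | cons x l ih => intro acc; simp [step, ih]
  have h₂ : ∀ (l acc : List Bool),
      (if (l.foldl step (true, acc)).1 = true then
        (l.foldl step (true, acc)).2.reverse ++ [true]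
      else (l.foldl step (true, acc)).2.reverse) = acc.reverse ++ _root_.incBits l := by
    intro l
    induction l with
    | nil => simp [_root_.incBits]
    | cons x l ih =>
      intro acc
      cases x
      · simp [step, h₁, _root_.incBits]
      · simpa [step, _root_.incBits] using ih (false :: acc)
  simpa using h₂ l []

theorem succ {f : α → ℕ} (hf : PolyTime f) : PolyTime fun a => f a + 1 :=
  (incBits.of_enc_eq (g := Nat.succ) Nat.bits (fun _ => rfl)
    fun n => by rw [← bits_succ]; rfl).comp hf

theorem length {l : α → List τ} (hl : PolyTime l) : PolyTime fun a => (l a).length :=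
  (hl.foldl (f := fun _ n _ => n + 1) (const 0) (fst.comp snd).succ
    ⟨4, fun a s x => (tsize_succ s).trans (by simp)⟩).of_eq fun a => by
      suffices h : ∀ (l : List τ) (n : ℕ), l.foldl (fun n _ => n + 1) n = n + l.length by
        simp [h]
      intro l
      induction l with
      | nil => simp
      | cons x l ih => intro n; simp [ih]; omega

end PolyTime

/-- `min k l.length` elements of the list `l`. -/
def cut {τ : Type} (k : ℕ) (l : List τ) : List τ :=
  l.foldl (fun s x => if decide (s.length = k) then s else x :: s) []

/-- A parameter in binary can be exponentially larger than its tree. Truncating it at the length of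
a list gives a unary number that is short enough to compute with, and still decides whether `k`
exceeds that length. -/
theorem length_cut {τ : Type} (k : ℕ) (l : List τ) : (cut k l).length = min k l.length := by
  suffices h : ∀ (l s : List τ), s.length ≤ k →
      (l.foldl (fun s x => if decide (s.length = k) then s else x :: s) s).length =
        min k (s.length + l.length) by
    simpa [cut] using h l []
  intro l
  induction l with
  | nil => intro s hs; simp [hs]
  | cons x l ih =>
    intro s hs
    rw [List.foldl_cons]
    by_cases h : s.length = k
    · rw [if_pos (by simpa using h), ih s hs]
      simp only [List.length_cons]; omega
    · rw [if_neg (by simpa using h), ih _ (by simp only [List.length_cons]; omega)]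
      simp only [List.length_cons]; omega

namespace PolyTime

theorem cut {k : α → ℕ} {l : α → List τ} (hk : PolyTime k) (hl : PolyTime l) :
    PolyTime fun a => _root_.cut (k a) (l a) :=
  hl.foldl (f := fun a (s : List τ) x => if decide (s.length = k a) then s else x :: s) (const [])
    ((PolyEq.nat.decide_eq (fst.comp snd).length (hk.comp fst)).ite (fst.comp snd)
      ((snd.comp snd).cons (fst.comp snd)))
    ⟨.X, fun a s x => by
      simp only [Polynomial.eval_X, tsize_pair]
      split
      · omega
      · rw [tsize_cons]; omega⟩

theorem le_length {k : α → ℕ} {l : α → List τ} (hk : PolyTime k) (hl : PolyTime l) :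
    PolyTime fun a => decide (k a ≤ (l a).length) :=
  (PolyEq.nat.decide_eq (hk.cut hl).length hk).of_eq fun a => by
    rw [length_cut]
    simp

end PolyTime

/-- The list without repetitions. -/
def nub {τ : Type} [DecidableEq τ] (l : List τ) : List τ :=
  l.foldl (fun s x => if decide (x ∈ s) then s else x :: s) []

theorem nub_spec {τ : Type} [DecidableEq τ] (l : List τ) :
    (nub l).Nodup ∧ ∀ x, x ∈ nub l ↔ x ∈ l := by
  suffices h : ∀ l s : List τ, s.Nodup →
      (l.foldl (fun s x => if decide (x ∈ s) then s else x :: s) s).Nodup ∧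
        ∀ x, x ∈ l.foldl (fun s x => if decide (x ∈ s) then s else x :: s) s ↔ x ∈ s ∨ x ∈ l by
    simpa [nub] using h l [] List.nodup_nil
  intro l
  induction l with
  | nil => intro s hs; simpa using hs
  | cons y l ih =>
    intro s hs
    rw [List.foldl_cons]
    by_cases h : y ∈ s
    · rw [if_pos (by simpa using h)]
      refine ⟨(ih s hs).1, fun x => ?_⟩
      rw [(ih s hs).2, List.mem_cons]
      constructor
      · tauto
      · rintro (h | rfl | h) <;> tauto
    · rw [if_neg (by simpa using h)]
      have hs' := List.nodup_cons.2 ⟨h, hs⟩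
      refine ⟨(ih _ hs').1, fun x => ?_⟩
      rw [(ih _ hs').2, List.mem_cons, List.mem_cons]
      tauto

theorem nodup_nub {τ : Type} [DecidableEq τ] (l : List τ) : (nub l).Nodup := (nub_spec l).1

theorem mem_nub {τ : Type} [DecidableEq τ] {l : List τ} {x : τ} : x ∈ nub l ↔ x ∈ l :=
  (nub_spec l).2 x

theorem PolyTime.nub [DecidableEq τ] (h : PolyEq τ) {l : α → List τ} (hl : PolyTime l) :
    PolyTime fun a => _root_.nub (l a) :=
  hl.foldl (f := fun _ (s : List τ) x => if decide (x ∈ s) then s else x :: s) (const [])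
    ((mem h (snd.comp snd) (fst.comp snd)).ite (fst.comp snd) ((snd.comp snd).cons (fst.comp snd)))
    ⟨.X, fun a s x => by
      simp only [Polynomial.eval_X, tsize_pair]
      split
      · omega
      · rw [tsize_cons]; omega⟩

theorem PolyTime.idxOf [DecidableEq τ] (h : PolyEq τ) {x : α → τ} {l : α → List τ}
    (hx : PolyTime x) (hl : PolyTime l) : PolyTime fun a => (l a).idxOf (x a) := by
  -- The flag records that the element has been found; from then on the counter stands still.
  let step : τ → Bool × ℕ → τ → Bool × ℕ := fun x s y =>
    if s.1 || decide (y = x) then (true, s.2) else (false, s.2 + 1)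
  have hloop : PolyTime fun a => (l a).foldl (step (x a)) (false, 0) :=
    hl.foldl (f := fun a => step (x a)) (const _)
      (((fst.comp (fst.comp snd)).or (h.decide_eq (snd.comp snd) (hx.comp fst))).ite
        ((const true).pair (snd.comp (fst.comp snd)))
        ((const false).pair (snd.comp (fst.comp snd)).succ))
      ⟨7, fun a s y => by
        have h₁ := tsize_bool true
        have h₂ := tsize_bool false
        have h₃ := tsize_pos s.1
        have h₄ := tsize_succ s.2
        rw [← Prod.mk.eta (p := s)]
        simp only [step, Polynomial.eval_ofNat]
        split <;> simp only [tsize_pair] at * <;> omega⟩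
  refine (snd.comp hloop).of_eq fun a => ?_
  have h₁ : ∀ (l : List τ) (n : ℕ), l.foldl (step (x a)) (true, n) = (true, n) := by
    intro l
    induction l with
    | nil => simp
    | cons y l ih => intro n; rw [List.foldl_cons]; exact ih n
  have h₂ : ∀ (l : List τ) (n : ℕ),
      (l.foldl (step (x a)) (false, n)).2 = n + l.idxOf (x a) := by
    intro l
    induction l with
    | nil => simp
    | cons y l ih =>
      intro n
      by_cases hy : y = x a
      · have : step (x a) (false, n) y = (true, n) := by simp [step, hy]
        rw [List.foldl_cons, this, h₁, hy, List.idxOf_cons_self, Nat.add_zero]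
      · rw [List.foldl_cons, List.idxOf_cons_ne _ hy]
        simp only [step, Bool.false_or, hy, decide_false, Bool.false_eq_true, if_false, ih]
        omega
  simpa using h₂ (l a) 0

end

/-! ### The maximum of an integral combination of characters -/

/-- The nontrivial character of `ZMod 2`. -/
def sgn (a : ZMod 2) : ℤ := if a = 0 then 1 else -1

theorem sgn_add (a b : ZMod 2) : sgn (a + b) = sgn a * sgn b := by
  revert a b; decide

theorem sgn_zero : sgn 0 = 1 := rfl

section
variable {V : Type} [Fintype V]

/-- The characters of `V → ZMod 2`. -/
def chi (s x : V → ZMod 2) : ℤ := sgn (s ⬝ᵥ x)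

theorem chi_zero (x : V → ZMod 2) : chi 0 x = 1 := by simp [chi, sgn_zero]

theorem chi_add (s t x : V → ZMod 2) : chi (s + t) x = chi s x * chi t x := by
  rw [chi, add_dotProduct, sgn_add, chi, chi]

theorem neg_one_le_chi (s x : V → ZMod 2) : -1 ≤ chi s x ∧ chi s x ≤ 1 := by
  unfold chi sgn; split <;> simp

theorem chi_sum (J : Finset (V → ZMod 2)) (x : V → ZMod 2) :
    chi (∑ s ∈ J, s) x = ∏ s ∈ J, chi s x := by
  classical
  induction J using Finset.induction_on with
  | empty => simp [chi_zero]
  | insert a J ha ih => rw [Finset.sum_insert ha, Finset.prod_insert ha, chi_add, ih]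

variable [DecidableEq V]

theorem ne_zero_iff_eq_one (a : ZMod 2) : a ≠ 0 ↔ a = 1 := by revert a; decide

theorem sum_chi_eq_zero {s : V → ZMod 2} (hs : s ≠ 0) : ∑ x, chi s x = 0 := by
  obtain ⟨i, hi⟩ := Function.ne_iff.1 hs
  have h : ∑ x, chi s x = ∑ x, -chi s x := by
    refine Fintype.sum_equiv (Equiv.addRight (Pi.single i 1)) _ _ fun x => ?_
    rw [Equiv.coe_addRight, chi, chi, dotProduct_add, dotProduct_single_one,
      (ne_zero_iff_eq_one _).1 hi, sgn_add, show sgn 1 = -1 from rfl]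
    ring
  rw [Finset.sum_neg_distrib] at h
  omega

theorem sum_chi_mul_chi (s t : V → ZMod 2) :
    ∑ x, chi s x * chi t x = if s = t then (2 : ℤ) ^ Fintype.card V else 0 := by
  simp_rw [← chi_add]
  split_ifs with h
  · subst h
    have : s + s = 0 := funext fun v => CharTwo.add_self_eq_zero _
    simp [this, chi_zero, ZMod.card]
  · refine sum_chi_eq_zero fun h' => h ?_
    have : s = -t := eq_neg_of_add_eq_zero_left h'
    rw [this]
    exact funext fun v => CharTwo.neg_eq _

/-- A combination of characters takes a value that is at least the sum of the absolute values of
its coefficients on a sum-free set of characters. -/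
theorem exists_sum_abs_le (w : (V → ZMod 2) → ℤ) (hw : w 0 = 0) (K : Finset (V → ZMod 2))
    (hK : ∀ s ∈ K, w s ≠ 0)
    (hfree : ∀ J ⊆ K, 2 ≤ J.card → ∑ s ∈ J, s ≠ 0 ∧ w (∑ s ∈ J, s) = 0) :
    ∃ x, ∑ s ∈ K, |w s| ≤ ∑ t, w t * chi t x := by
  by_contra! hcon
  set N : ℤ := 2 ^ Fintype.card V with hN
  have hN0 : 0 < N := by positivity
  -- The Riesz product: a nonnegative weight that favours assignments at which the characters in `K`
  -- agree with the signs of their coefficients.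
  let ρ : (V → ZMod 2) → ℤ := fun x => ∏ s ∈ K, (1 + (w s).sign * chi s x)
  have hρ0 : ∀ x, 0 ≤ ρ x := fun x => Finset.prod_nonneg fun s hs => by
    have h := neg_one_le_chi s x
    rcases (hK s hs).lt_or_gt with h' | h'
    · rw [Int.sign_eq_neg_one_of_neg h']; omega
    · rw [Int.sign_eq_one_of_pos h']; omega
  have hρ : ∀ x, ρ x = ∑ J ∈ K.powerset, (∏ s ∈ J, (w s).sign) * chi (∑ s ∈ J, s) x := by
    intro x
    simp only [ρ, Finset.prod_one_add, Finset.prod_mul_distrib, chi_sum]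
  have hsum : ∀ t, ∑ x, chi t x * ρ x =
      ∑ J ∈ K.powerset, if t = ∑ s ∈ J, s then (∏ s ∈ J, (w s).sign) * N else 0 := by
    intro t
    simp_rw [hρ, Finset.mul_sum]
    rw [Finset.sum_comm]
    refine Finset.sum_congr rfl fun J _ => ?_
    have := sum_chi_mul_chi t (∑ s ∈ J, s)
    rw [← hN] at this
    simp_rw [show ∀ x, chi t x * ((∏ s ∈ J, (w s).sign) * chi (∑ s ∈ J, s) x) =
      (∏ s ∈ J, (w s).sign) * (chi t x * chi (∑ s ∈ J, s) x) from fun x => by ring]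
    rw [← Finset.mul_sum, this]
    split_ifs <;> simp
  -- Only the empty subset of `K` sums to zero, so only the constant term of the expanded product
  -- survives.
  have hone : ∑ x, ρ x = N := by
    have h := hsum 0
    simp only [chi_zero, one_mul] at h
    rw [h, Finset.sum_eq_single ∅]
    · simp
    · intro J hJ hne
      rw [if_neg]
      rw [Finset.mem_powerset] at hJ
      rcases Nat.lt_or_ge J.card 2 with hc | hc
      · have : J.card = 1 := by
          have := Finset.card_pos.2 (Finset.nonempty_iff_ne_empty.2 hne); omega
        obtain ⟨s, rfl⟩ := Finset.card_eq_one.1 this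
        rw [Finset.sum_singleton]
        rintro rfl
        exact hK 0 (hJ (Finset.mem_singleton_self _)) hw
      · exact (hfree J hJ hc).1.symm
    · simp
  -- By orthogonality a subset `J` of `K` contributes the coefficient of the character `∑ s ∈ J, s`.
  -- This vanishes unless `J` is a singleton, which contributes `|w s|`.
  have hf : ∑ x, (∑ t, w t * chi t x) * ρ x = N * ∑ s ∈ K, |w s| := by
    simp_rw [Finset.sum_mul]
    rw [Finset.sum_comm]
    simp_rw [mul_assoc, ← Finset.mul_sum, hsum]
    simp_rw [Finset.mul_sum]
    rw [Finset.sum_comm]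
    simp_rw [mul_ite, mul_zero]
    simp only [Finset.sum_ite_eq', Finset.mem_univ, if_true]
    have hsub : K.powersetCard 1 ⊆ K.powerset := fun J hJ =>
      Finset.mem_powerset.2 (Finset.mem_powersetCard.1 hJ).1
    rw [← Finset.sum_subset hsub]
    · rw [Finset.powersetCard_one, Finset.sum_map]
      refine Finset.sum_congr rfl fun s _ => ?_
      simp only [Function.Embedding.coeFn_mk, Finset.sum_singleton, Finset.prod_singleton]
      rw [← Int.sign_mul_self_eq_abs]; ring
    · intro J hJ hJ'
      rw [Finset.mem_powerset] at hJ
      have hc : J.card ≠ 1 := fun h => hJ' (Finset.mem_powersetCard.2 ⟨hJ, h⟩)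
      rcases Nat.lt_or_ge J.card 2 with h | h
      · have : J = ∅ := Finset.card_eq_zero.1 (by omega)
        subst this
        simp [hw]
      · rw [(hfree J hJ h).2, zero_mul]
  -- All values are integers, so under the negated claim the difference is at least one everywhere;
  -- yet its `ρ`-weighted sum is zero, while `ρ` has positive total.
  have hlt : ∑ x, ρ x * 1 ≤ ∑ x, ρ x * (∑ s ∈ K, |w s| - ∑ t, w t * chi t x) :=
    Finset.sum_le_sum fun x _ => mul_le_mul_of_nonneg_left (by have := hcon x; omega) (hρ0 x)
  simp_rw [mul_sub, mul_one] at hlt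
  rw [Finset.sum_sub_distrib, ← Finset.sum_mul, hone] at hlt
  simp_rw [mul_comm (ρ _)] at hlt
  rw [hf] at hlt
  omega

/-- A singleton is sum-free. If the coefficient vanishes, the empty set does the same service. -/
theorem exists_abs_le (w : (V → ZMod 2) → ℤ) (hw : w 0 = 0) (s : V → ZMod 2) :
    ∃ x, |w s| ≤ ∑ t, w t * chi t x := by
  by_cases hs : w s = 0
  · obtain ⟨x, hx⟩ := exists_sum_abs_le w hw ∅ (by simp) fun J hJ h => by
      simp [Finset.subset_empty.1 hJ] at h
    exact ⟨x, by simpa [hs] using hx⟩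
  · obtain ⟨x, hx⟩ := exists_sum_abs_le w hw {s} (by simpa using hs) fun J hJ h => by
      have := Finset.card_le_card hJ
      simp at this; omega
    exact ⟨x, by simpa using hx⟩

theorem hammingNorm_sum_le (K : Finset (V → ZMod 2)) :
    hammingNorm (∑ s ∈ K, s) ≤ ∑ s ∈ K, hammingNorm s := by
  refine le_trans (Finset.card_le_card (t := K.biUnion fun s => Finset.univ.filter
    fun v => s v ≠ 0) ?_) Finset.card_biUnion_le
  intro v hv
  simp only [Finset.mem_filter, Finset.mem_univ, true_and, Finset.mem_biUnion,
    Finset.sum_apply] at *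
  exact Finset.exists_ne_zero_of_sum_ne_zero hv

/-- If every coordinate is nonzero somewhere on `M`, then some sum of elements of `M` is nonzero in
at least half of the coordinates. -/
theorem exists_hammingNorm_ge (M : Finset (V → ZMod 2)) (hM : ∀ v, ∃ s ∈ M, s v ≠ 0) :
    ∃ K ⊆ M, Fintype.card V ≤ 2 * hammingNorm (∑ s ∈ K, s) := by
  -- A vector `y` indexed by characters selects a subset of `M`. Coordinate `v` of the selected sum
  -- is the dot product of `u v` with `y`, hence nonzero for exactly half of the `y` because `u v ≠
  -- 0`.
  let u : V → (V → ZMod 2) → ZMod 2 := fun v s => if s ∈ M then s v else 0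
  have hu : ∀ v, u v ≠ 0 := fun v h => by
    obtain ⟨s, hs, hv⟩ := hM v
    have := congrFun h s
    simp only [u, if_pos hs] at this
    exact hv this
  have h0 : ∑ y, ∑ v, chi (u v) y = 0 := by
    rw [Finset.sum_comm]
    exact Finset.sum_eq_zero fun v _ => sum_chi_eq_zero (hu v)
  -- The total over all `y` is zero, so some `y` has at least as many nonzero as zero coordinates in
  -- its sum.
  obtain ⟨y, -, hy⟩ := Finset.exists_le_of_sum_le (s := Finset.univ)
    (f := fun y => ∑ v, chi (u v) y) (g := fun _ => 0) Finset.univ_nonempty (by simp [h0])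
  refine ⟨M.filter fun s => y s ≠ 0, Finset.filter_subset _ _, ?_⟩
  set z := ∑ s ∈ M.filter (fun s => y s ≠ 0), s with hz
  have hzv : ∀ v, chi (u v) y = if z v ≠ 0 then -1 else 1 := by
    intro v
    have : u v ⬝ᵥ y = z v := by
      rw [hz, Finset.sum_apply, Finset.sum_filter, dotProduct]
      simp only [u, ite_mul, zero_mul, Finset.sum_ite_mem, Finset.univ_inter]
      refine Finset.sum_congr rfl fun s _ => ?_
      by_cases h : y s = 0
      · simp [h]
      · rw [if_pos h, (ne_zero_iff_eq_one _).1 h, mul_one]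
    rw [chi, this, sgn]
    split_ifs <;> simp_all
  simp_rw [hzv] at hy
  rw [Finset.sum_ite, Finset.sum_const, Finset.sum_const] at hy
  have hcard := Finset.card_filter_add_card_filter_not (s := (Finset.univ : Finset V))
    (fun v => z v ≠ 0)
  rw [Finset.card_univ] at hcard
  simp only [nsmul_eq_mul, mul_neg, mul_one] at hy
  unfold hammingNorm
  omega

/-- If the coefficients of an integral combination of characters of weight at most `r` are supported
on more than `2 * r * k` coordinates, then it takes a value that is at least `k`. -/
theorem exists_le_of_lt_card (w : (V → ZMod 2) → ℤ) (hw : w 0 = 0) (r k : ℕ)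
    (hr : ∀ s, w s ≠ 0 → hammingNorm s ≤ r) (hV : ∀ v, ∃ s, w s ≠ 0 ∧ s v ≠ 0)
    (hk : 2 * r * k < Fintype.card V) : ∃ x, (k : ℤ) ≤ ∑ t, w t * chi t x := by
  classical
  set M : Finset (V → ZMod 2) := Finset.univ.filter fun s => w s ≠ 0 with hM
  have hMw : ∀ s, s ∈ M ↔ w s ≠ 0 := fun s => by simp [hM]
  obtain ⟨K₀, hK₀, hz⟩ := exists_hammingNorm_ge M fun v => by
    obtain ⟨s, h₁, h₂⟩ := hV v
    exact ⟨s, (hMw s).2 h₁, h₂⟩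
  -- Among the sets of characters with this sum, a smallest one is sum-free: a violating subset
  -- could be removed or replaced by a single character.
  obtain ⟨K, hK, hmin⟩ := Finset.exists_min_image
    (M.powerset.filter fun K => ∑ s ∈ K, s = ∑ s ∈ K₀, s) Finset.card
    ⟨K₀, by simp [hK₀]⟩
  rw [Finset.mem_filter, Finset.mem_powerset] at hK
  have hmin' : ∀ L ⊆ M, ∑ s ∈ L, s = ∑ s ∈ K₀, s → K.card ≤ L.card := fun L h₁ h₂ =>
    hmin L (Finset.mem_filter.2 ⟨Finset.mem_powerset.2 h₁, h₂⟩)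
  obtain ⟨x, hx⟩ := exists_sum_abs_le w hw K (fun s hs => (hMw s).1 (hK.1 hs)) (by
    intro J hJ hc
    have hcard := Finset.card_sdiff_add_card_eq_card hJ
    have hsplit := Finset.sum_sdiff (f := fun s : V → ZMod 2 => s) hJ
    rw [hK.2] at hsplit
    have hsub : K \ J ⊆ M := Finset.sdiff_subset.trans hK.1
    refine ⟨fun h => ?_, by_contra fun h => ?_⟩
    · rw [h, add_zero] at hsplit
      have := hmin' _ hsub hsplit
      omega
    -- Replace `J` by its sum `m`. If `m` already lies in `K \ J`, the two copies cancel and `m` is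
    -- erased instead. Both ways the set gets smaller, since `J` has at least two elements.
    · set m := ∑ s ∈ J, s
      by_cases hm : m ∈ K \ J
      · have h₁ := Finset.sum_erase_add _ (fun s : V → ZMod 2 => s) hm
        have h₂ : m + m = 0 := funext fun v => CharTwo.add_self_eq_zero _
        rw [← h₁, add_assoc, h₂, add_zero] at hsplit
        have := hmin' _ ((Finset.erase_subset _ _).trans hsub) hsplit
        have := Finset.card_erase_le (s := K \ J) (a := m)
        omega
      · have h₁ := Finset.sum_insert (f := fun s : V → ZMod 2 => s) hm
        have := hmin' (insert m (K \ J)) (Finset.insert_subset ((hMw m).2 h) hsub)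
          (by rw [h₁, add_comm]; exact hsplit)
        rw [Finset.card_insert_of_notMem hm] at this
        omega)
  refine ⟨x, le_trans ?_ hx⟩
  have h₁ : (K.card : ℤ) ≤ ∑ s ∈ K, |w s| := by
    rw [Finset.card_eq_sum_ones, Nat.cast_sum]
    exact Finset.sum_le_sum fun s hs => by
      have := abs_pos.2 ((hMw s).1 (hK.1 hs)); push_cast; omega
  have h₂ : hammingNorm (∑ s ∈ K₀, s) ≤ K.card * r := by
    rw [← hK.2]
    exact (hammingNorm_sum_le K).trans
      ((Finset.sum_le_card_nsmul _ _ r fun s hs => hr s ((hMw s).1 (hK.1 hs))).trans_eq (by simp))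
  -- The sum has weight at least half the number of coordinates, and each of its summands has weight
  -- at most `r`.
  have h₃ : k < K.card := by
    by_contra! h
    have : K.card * r ≤ k * r := Nat.mul_le_mul_right r h
    have : 2 * r * k = 2 * (k * r) := by ring
    omega
  omega

end

/-! ### The kernelization algorithm -/

def BTree.left : BTree → BTree
  | .nil => .nil
  | .cons a _ => a

def BTree.right : BTree → BTree
  | .nil => .nil
  | .cons _ b => b

def BTree.isCons : BTree → Bool
  | .nil => false
  | .cons _ _ => true

/-- A product of signs `(-1) ^ x v`, with its own sign, which is `-1` if the flag is set. -/
abbrev Term := List ℕ × Bool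

/-- The Fourier expansion of `2 ^ d` times a Boolean function, given by its truth table. -/
def expand : ℕ → BTree → List ℕ → List Term
  | 0, t, _ => if t.isCons then [([], false)] else []
  | d + 1, t, [] => expand d t [] ++ expand d t []
  | d + 1, t, v :: vs =>
    (expand d t.left vs ++ expand d t.right vs) ++
      ((expand d t.left vs).map (fun e => (v :: e.1, e.2)) ++
        (expand d t.right vs).map (fun e => (v :: e.1, !e.2)))

def allTerms (r : ℕ) (cs : List (List ℕ × BTree)) : List Term :=
  cs.flatMap fun c => expand r c.2 c.1

def nonconstTerms (r : ℕ) (cs : List (List ℕ × BTree)) : List Term :=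
  (allTerms r cs).filter fun e => !e.1.isEmpty

def termVars (T : List Term) : List ℕ := nub (T.flatMap fun e => e.1)

/-- The terms with their variables in a common order. -/
def canonTerms (T : List Term) : List Term :=
  T.map fun e => ((termVars T).filter fun v => decide (v ∈ e.1), e.2)

/-- The terms that are not cancelled by terms of the opposite sign, each with a list of copies. -/
def collect (T : List Term) : List (Term × List Term) :=
  ((nub T).map fun e => (e, (T.filter fun e' => decide (e' = e)).drop
    (T.filter fun e' => decide (e' = (e.1, !e.2))).length)).filter fun q => !q.2.isEmpty

/-- The reduced weighted terms of a collection of Boolean functions. -/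
def reduced (r : ℕ) (cs : List (List ℕ × BTree)) : List (Term × List Term) :=
  collect (canonTerms (nonconstTerms r cs))

def suppVars (E : List (Term × List Term)) : List ℕ := nub (E.flatMap fun q => q.1.1)

def copies {τ : Type} : ℕ → List τ → List τ
  | 0, _ => []
  | n + 1, l => l ++ copies n l

/-- Some weight is at least `k`, or there are more than `2 * r * k` variables. -/
def isLarge (r : ℕ) (E : List (Term × List Term)) (k : ℕ) : Bool :=
  (E.any fun q => decide (k ≤ q.2.length)) ||
    !((suppVars E).drop (copies (2 * r) (cut k (suppVars E))).length).isEmpty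

def relabel (E : List (Term × List Term)) : List (List ℕ × ℕ × ℕ) :=
  E.map fun q =>
    (q.1.1.map fun v => (suppVars E).idxOf v, (if q.1.2 then 1 else 0), q.2.length)

/-- The tree data of the kernel. -/
def rawKernel (r : ℕ) (x : (ℕ × List (List ℕ × BTree)) × ℕ) :
    (ℕ × List (List ℕ × ℕ × ℕ)) × ℕ :=
  if isLarge r (reduced r x.1.2) x.2 then ((0, []), 0)
  else (((suppVars (reduced r x.1.2)).length, relabel (reduced r x.1.2)), x.2)

/-- All sublists of a list. -/
def sublistsOf (l : List ℕ) : List (List ℕ) :=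
  l.foldl (fun s v => s ++ s.map fun A => v :: A) [[]]

/-- The sign of a term if exactly the variables in `A` are true. -/
def parity (A : List ℕ) (e : Term) : Bool :=
  e.1.foldl (fun b v => b ^^ decide (v ∈ A)) e.2

/-- Can the value `k` be reached by making exactly the variables in one of the lists true? -/
def search (k : ℕ) (E : List (Term × List Term)) (L : List (List ℕ)) : Bool :=
  L.any fun A => decide (k ≤ ((E.flatMap fun q => if parity A q.1 then [] else q.2).drop
    (E.flatMap fun q => if parity A q.1 then q.2 else []).length).length)

/-! ### Running time of the reduction and of the search -/

namespace PolyTime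

theorem left : PolyTime BTree.left :=
  ⟨.fst, .X + 1, fun t => by
    cases t with
    | nil => exact ⟨_, by simp [tsize, enc], .fst_nil⟩
    | cons a b => exact ⟨_, by simp [tsize, enc], .fst_cons a b⟩⟩

theorem right : PolyTime BTree.right :=
  ⟨.snd, .X + 1, fun t => by
    cases t with
    | nil => exact ⟨_, by simp [tsize, enc], .snd_nil⟩
    | cons a b => exact ⟨_, by simp [tsize, enc], .snd_cons a b⟩⟩

theorem isCons : PolyTime BTree.isCons := by
  obtain ⟨p, P, hp⟩ := const (α := BTree) true
  obtain ⟨q, Q, hq⟩ := const (α := BTree) false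
  refine ⟨.branch .id p q, P + Q + 2 * .X + 2, fun t => ?_⟩
  obtain ⟨u, hu, h⟩ := hp t
  obtain ⟨v, hv, h'⟩ := hq t
  simp only [Polynomial.eval_add, Polynomial.eval_mul, Polynomial.eval_X, Polynomial.eval_ofNat]
  cases t with
  | nil => exact ⟨_, by simp only [tsize, enc] at *; omega, .branch_false (.id _) h'⟩
  | cons a b => exact ⟨_, by simp only [tsize, enc] at *; omega, .branch_true (.id _) h⟩

/-- The depth is a constant, so the recursion is unrolled into the program; the degree of the time
bound may depend on `d`. -/
theorem expand (d : ℕ) : PolyTime fun p : BTree × List ℕ => expand d p.1 p.2 := by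
  induction d with
  | zero =>
    exact (isCons.comp fst).ite (const _) (const _)
  | succ d ih =>
    have h0 : PolyTime fun p : BTree × List ℕ => _root_.expand d p.1 [] :=
      ih.comp (fst.pair (const []))
    have hA : PolyTime fun p : (BTree × List ℕ) × ℕ × List ℕ =>
        _root_.expand d p.1.1.left p.2.2 :=
      ih.comp ((left.comp (fst.comp fst)).pair (snd.comp snd))
    have hB : PolyTime fun p : (BTree × List ℕ) × ℕ × List ℕ =>
        _root_.expand d p.1.1.right p.2.2 :=
      ih.comp ((right.comp (fst.comp fst)).pair (snd.comp snd))
    have hv : PolyTime fun p : ((BTree × List ℕ) × ℕ × List ℕ) × Term => p.1.2.1 :=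
      fst.comp (snd.comp fst)
    have h1 := (hA.append hB).append
      ((hA.map (f := fun p e => (p.2.1 :: e.1, e.2))
        ((hv.cons (fst.comp snd)).pair (snd.comp snd))).append
        (hB.map (f := fun p e => (p.2.1 :: e.1, !e.2))
          ((hv.cons (fst.comp snd)).pair (snd.comp snd).not)))
    refine (listCases (l := fun p : BTree × List ℕ => p.2) (g := fun p v vs =>
      (_root_.expand d p.1.left vs ++ _root_.expand d p.1.right vs) ++
      ((_root_.expand d p.1.left vs).map (fun e => (v :: e.1, e.2)) ++
        (_root_.expand d p.1.right vs).map (fun e => (v :: e.1, !e.2))))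
        snd (h0.append h0) h1).of_eq fun p => ?_
    rcases p with ⟨t, _ | ⟨v, vs⟩⟩ <;> rfl

theorem polyEq_term : PolyEq Term := PolyEq.nat.list.prod PolyEq.bool

theorem nonconstTerms (r : ℕ) : PolyTime (nonconstTerms r) :=
  (id.flatMap (f := fun _ (c : List ℕ × BTree) => _root_.expand r c.2 c.1)
    ((expand r).comp ((snd.comp snd).pair (fst.comp snd)))).filter (f := fun _ (e : Term) => !e.1.isEmpty)
      (fst.comp snd).isEmpty.not

theorem canonTerms : PolyTime canonTerms := by
  have hU : PolyTime termVars :=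
    (id.flatMap (f := fun _ (e : Term) => e.1) (fst.comp snd)).nub PolyEq.nat
  exact id.map (f := fun (T : List Term) (e : Term) => ((termVars T).filter fun v => decide (v ∈ e.1), e.2))
    (((hU.comp fst).filter (f := fun p v => decide (v ∈ p.2.1))
      (mem PolyEq.nat snd (fst.comp (snd.comp fst)))).pair (snd.comp snd))

theorem collect : PolyTime collect := by
  have h₁ : PolyTime fun p : List Term × Term => p.1.filter fun e' => decide (e' = p.2) :=
    fst.filter (f := fun p e' => decide (e' = p.2)) (polyEq_term.decide_eq snd (snd.comp fst))
  have h₂ : PolyTime fun p : List Term × Term =>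
      p.1.filter fun e' => decide (e' = (p.2.1, !p.2.2)) :=
    h₁.comp (fst.pair ((fst.comp snd).pair (snd.comp snd).not))
  exact ((id.nub polyEq_term).map (snd.pair (h₁.drop_length h₂))).filter (f := fun _ (q : Term × List Term) => !q.2.isEmpty)
    (snd.comp snd).isEmpty.not

theorem reduced (r : ℕ) : PolyTime (reduced r) :=
  collect.comp (canonTerms.comp (nonconstTerms r))

theorem suppVars : PolyTime suppVars :=
  (id.flatMap (f := fun _ (q : Term × List Term) => q.1.1) (fst.comp (fst.comp snd))).nub PolyEq.nat

theorem copies {α τ : Type} [TreeEnc α] [TreeEnc τ] {l : α → List τ} (hl : PolyTime l) (n : ℕ) :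
    PolyTime fun a => copies n (l a) := by
  induction n with
  | zero => exact const []
  | succ n ih => exact hl.append ih

theorem isLarge (r : ℕ) :
    PolyTime fun p : List (Term × List Term) × ℕ => isLarge r p.1 p.2 := by
  have hV : PolyTime fun p : List (Term × List Term) × ℕ => _root_.suppVars p.1 :=
    suppVars.comp fst
  exact (fst.any (f := fun p q => decide (p.2 ≤ q.2.length))
    ((snd.comp fst).le_length (snd.comp snd))).or
      (hV.drop_length ((snd.cut hV).copies (2 * r))).isEmpty.not

theorem relabel : PolyTime relabel :=
  id.map (f := fun (E : List (Term × List Term)) (q : Term × List Term) =>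
    (q.1.1.map fun v => (_root_.suppVars E).idxOf v, (if q.1.2 then 1 else 0), q.2.length))
    (((fst.comp (fst.comp snd)).map (f := fun p v => (_root_.suppVars p.1).idxOf v)
      (idxOf PolyEq.nat snd (suppVars.comp (fst.comp fst)))).pair
      (((snd.comp (fst.comp snd)).ite (const 1) (const 0)).pair (snd.comp snd).length))

theorem rawKernel (r : ℕ) : PolyTime (rawKernel r) := by
  have hE : PolyTime fun x : (ℕ × List (List ℕ × BTree)) × ℕ => _root_.reduced r x.1.2 :=
    (reduced r).comp (snd.comp fst)
  exact ((isLarge r).comp (hE.pair snd)).ite (const _)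
    (((suppVars.comp hE).length.pair (relabel.comp hE)).pair snd)

theorem parity : PolyTime fun p : List ℕ × Term => parity p.1 p.2 :=
  (fst.comp snd).foldl (f := fun (p : List ℕ × Term) b v => b ^^ decide (v ∈ p.1)) (snd.comp snd)
    ((fst.comp snd).xor (mem PolyEq.nat (snd.comp snd) (fst.comp fst)))
    ⟨3, fun a s x => (tsize_bool _).trans (by simp)⟩

theorem search :
    PolyTime fun p : ℕ × List (Term × List Term) × List (List ℕ) => search p.1 p.2.1 p.2.2 := by
  have hp : PolyTime fun p : ((ℕ × List (Term × List Term) × List (List ℕ)) × List ℕ) ×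
      (Term × List Term) => _root_.parity p.1.2 p.2.1 :=
    parity.comp ((snd.comp fst).pair (fst.comp snd))
  have hE : PolyTime fun p : (ℕ × List (Term × List Term) × List (List ℕ)) × List ℕ => p.1.2.1 :=
    fst.comp (snd.comp fst)
  exact (snd.comp snd).any (f := fun (p : ℕ × List (Term × List Term) × List (List ℕ)) A => decide (p.1 ≤
    ((p.2.1.flatMap fun q => if _root_.parity A q.1 then [] else q.2).drop
    (p.2.1.flatMap fun q => if _root_.parity A q.1 then q.2 else []).length).length))
    ((fst.comp fst).le_length ((hE.flatMap (f := fun p q => if _root_.parity p.2 q.1 then [] else q.2)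
      (hp.ite (const []) (snd.comp snd))).drop_length
      (hE.flatMap (f := fun p q => if _root_.parity p.2 q.1 then q.2 else [])
      (hp.ite (snd.comp snd) (const [])))))

end PolyTime

/-- Each round doubles the number of lists and adds one element to each new copy. In the invariant,
`s.length * tsize l` pays in advance for the elements still to be added. -/
theorem tsize_sublistsOf_le (l : List ℕ) : tsize (sublistsOf l) ≤ 2 ^ l.length * (2 * tsize l + 4) := by
  suffices h : ∀ (l : List ℕ) (s : List (List ℕ)),
      tsize (l.foldl (fun s v => s ++ s.map fun A => v :: A) s) ≤
        2 ^ l.length * (tsize s + s.length * tsize l) by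
    refine (h l [[]]).trans (Nat.mul_le_mul_left _ ?_)
    simp only [tsize_cons, tsize_nil, List.length_singleton]; omega
  intro l
  induction l with
  | nil => intro s; simp
  | cons v l ih =>
    intro s
    rw [List.foldl_cons]
    refine (ih _).trans ?_
    have h₁ := tsize_append s (s.map fun A => v :: A)
    have h₂ : tsize (s.map fun A => v :: A) = tsize s + s.length * (tsize v + 1) := by
      induction s with
      | nil => simp [tsize_nil]
      | cons A s ihs =>
        rw [List.map_cons, tsize_cons, tsize_cons, tsize_cons, List.length_cons, Nat.succ_mul, ihs
          (tsize_append _ _)]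
        omega
    rw [List.length_append, List.length_map, List.length_cons, pow_succ, mul_assoc, tsize_cons]
    refine Nat.mul_le_mul_left _ ?_
    have h₃ : s.length * (tsize v + 1) + s.length * tsize l = s.length * (tsize v + tsize l + 1) := by
      ring
    have h₄ : s.length * (tsize v + 1) ≤ 2 * (s.length * (tsize v + 1)) := by omega
    have h₅ : (s.length + s.length) * tsize l = 2 * (s.length * tsize l) := by ring
    omega

/-! ### Correctness of the reduction -/

/-- The sign of a flag. -/
def sg (b : Bool) : ℤ := if b then -1 else 1

theorem sg_not (b : Bool) : sg (!b) = -sg b := by cases b <;> rfl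

/-- The value of a term at an assignment. -/
def termVal (x : ℕ → Bool) (e : Term) : ℤ := sg e.2 * (e.1.map fun v => sg (x v)).prod

def termsVal (x : ℕ → Bool) (T : List Term) : ℤ := (T.map (termVal x)).sum

theorem termsVal_append (x : ℕ → Bool) (T T' : List Term) :
    termsVal x (T ++ T') = termsVal x T + termsVal x T' := by simp [termsVal]

theorem termVal_neg (x : ℕ → Bool) (e : Term) : termVal x (e.1, !e.2) = -termVal x e := by
  simp [termVal, sg_not]

theorem termVal_congr {x y : ℕ → Bool} {e : Term} (h : ∀ v ∈ e.1, x v = y v) :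
    termVal x e = termVal y e := by
  unfold termVal
  rw [List.map_congr_left fun v hv => by rw [h v hv]]

/-- Splitting on the first variable, `2 * f = (f₀ + f₁) + (-1) ^ x v * (f₀ - f₁)`. Once the
variables are used up, the remaining levels merely double, so functions of any arity up to `d` share
the scale `2 ^ d`. -/
theorem termsVal_expand (x : ℕ → Bool) (d a : ℕ) (vs : List ℕ) (f : (Fin a → Bool) → Bool)
    (ha : vs.length = a) (hd : a ≤ d) :
    termsVal x (expand d (encTable a f) vs) =
      if f (fun j => x (vs.getD j 0)) then 2 ^ d else 0 := by
  induction d generalizing a vs with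
  | zero =>
    obtain rfl : a = 0 := by omega
    rw [Subsingleton.elim (fun j : Fin 0 => x (vs.getD j 0)) Fin.elim0]
    cases h : f Fin.elim0 <;> simp [expand, encTable, h, encBool, BTree.isCons, termsVal, termVal, sg]
  | succ d ih =>
    cases vs with
    | nil =>
      obtain rfl : a = 0 := by simpa using ha.symm
      rw [expand, termsVal_append, ih 0 [] f rfl (by omega)]
      split_ifs <;> ring
    | cons v vs =>
      obtain ⟨a, rfl⟩ : ∃ b, a = b + 1 := ⟨vs.length, by simpa using ha.symm⟩
      have ha' : vs.length = a := by simpa using ha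
      have h₁ : ∀ T : List Term, termsVal x (T.map fun e => (v :: e.1, e.2)) =
          sg (x v) * termsVal x T := by
        intro T
        simp only [termsVal, List.map_map, ← List.sum_map_mul_left]
        congr 2
        funext e
        simp [termVal]; ring
      have h₂ : ∀ T : List Term, termsVal x (T.map fun e => (v :: e.1, !e.2)) =
          -(sg (x v) * termsVal x T) := by
        intro T
        rw [← neg_mul]
        simp only [termsVal, List.map_map, ← List.sum_map_mul_left]
        congr 2
        funext e
        simp [termVal, sg_not]; ring
      have h₃ : (fun j : Fin (a + 1) => x ((v :: vs).getD j 0)) =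
          Fin.cons (x v) fun j : Fin a => x (vs.getD j 0) := by
        funext j
        refine Fin.cases ?_ (fun j => ?_) j <;> simp
      rw [expand, termsVal_append, termsVal_append, termsVal_append, h₁, h₂, h₃]
      simp only [encTable, BTree.left, BTree.right]
      rw [ih a vs _ ha' (by omega), ih a vs _ ha' (by omega)]
      cases x v <;> simp only [sg, Bool.false_eq_true, if_false, if_true] <;> split_ifs <;> ring

theorem sublist_of_mem_expand {d : ℕ} {t : BTree} {vs : List ℕ} {e : Term}
    (he : e ∈ expand d t vs) : e.1.Sublist vs := by
  induction d generalizing t vs e with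
  | zero =>
    rw [expand] at he
    split_ifs at he
    · rw [List.mem_singleton.1 he]; exact List.nil_sublist _
    · simp at he
  | succ d ih =>
    cases vs with
    | nil =>
      rw [expand, List.mem_append, or_self] at he
      exact ih he
    | cons v vs =>
      rw [expand] at he
      simp only [List.mem_append, List.mem_map] at he
      rcases he with (he | he) | ⟨e', he, rfl⟩ | ⟨e', he, rfl⟩
      · exact (ih he).cons v
      · exact (ih he).cons v
      · exact (ih he).cons_cons v
      · exact (ih he).cons_cons v

theorem mem_canonTerms {T : List Term} {e : Term} (he : e ∈ canonTerms T) :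
    ∃ e' ∈ T, e = ((termVars T).filter fun v => decide (v ∈ e'.1), e'.2) := by
  obtain ⟨e', h, rfl⟩ := List.mem_map.1 he
  exact ⟨e', h, rfl⟩

theorem perm_canon {T : List Term} {e : Term} (he : e ∈ T) (hn : e.1.Nodup) :
    ((termVars T).filter fun v => decide (v ∈ e.1)).Perm e.1 := by
  have hU : (termVars T).Nodup := nodup_nub _
  rw [List.perm_ext_iff_of_nodup (hU.filter _) hn]
  intro v
  simp only [List.mem_filter, termVars, mem_nub, List.mem_flatMap, decide_eq_true_eq]
  exact ⟨fun h => h.2, fun h => ⟨⟨e, he, h⟩, h⟩⟩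

/-- Both variable lists are filtered from the same list, so equal sets of variables give equal
lists. Like terms can then be recognised by equality. -/
theorem canonTerms_eq {T : List Term} {e e' : Term} (he : e ∈ canonTerms T)
    (he' : e' ∈ canonTerms T) (h : ∀ v, v ∈ e.1 ↔ v ∈ e'.1) : e.1 = e'.1 := by
  obtain ⟨f, hf, rfl⟩ := mem_canonTerms he
  obtain ⟨g, hg, rfl⟩ := mem_canonTerms he'
  refine List.filter_congr fun v hv => ?_
  have := h v
  simp only [List.mem_filter, hv, true_and, decide_eq_true_eq] at this
  rw [decide_eq_decide]
  exact this

theorem termsVal_canonTerms (x : ℕ → Bool) {T : List Term} (hT : ∀ e ∈ T, e.1.Nodup) :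
    termsVal x (canonTerms T) = termsVal x T := by
  rw [termsVal, canonTerms, List.map_map, termsVal]
  congr 1
  refine List.map_congr_left fun e he => ?_
  simp only [Function.comp_apply, termVal]
  rw [((perm_canon he (hT e he)).map _).prod_eq]

theorem length_filter_eq_count (T : List Term) (e : Term) :
    (T.filter fun e' => decide (e' = e)).length = T.count e := by
  rw [List.count, List.countP_eq_length_filter]
  congr 1
  exact List.filter_congr fun e' _ => by rw [Bool.eq_iff_iff]; simp

theorem mem_collect {T : List Term} {q : Term × List Term} (hq : q ∈ collect T) :
    q.1 ∈ T ∧ q.2 ≠ [] ∧ q.2.length = T.count q.1 - T.count (q.1.1, !q.1.2) ∧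
      q.2 = (T.filter fun e' => decide (e' = q.1)).drop
        (T.filter fun e' => decide (e' = (q.1.1, !q.1.2))).length := by
  rw [collect, List.mem_filter, List.mem_map] at hq
  obtain ⟨⟨e, he, rfl⟩, h⟩ := hq
  refine ⟨mem_nub.1 he, by simpa using h, ?_, rfl⟩
  simp only [List.length_drop, length_filter_eq_count]

/-- The value of weighted terms at an assignment. -/
def weightedVal (x : ℕ → Bool) (E : List (Term × List Term)) : ℤ :=
  (E.map fun q => (q.2.length : ℤ) * termVal x q.1).sum

/-- The multiplicity of a term is its truncated excess over the opposite term plus the minimum of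
the two multiplicities. The minimum is the same for both terms while their values are opposite, so
these parts cancel under the involution that flips the sign. -/
theorem weightedVal_collect (x : ℕ → Bool) (T : List Term) :
    weightedVal x (collect T) = termsVal x T := by
  have h₁ : weightedVal x (collect T) =
      ∑ e ∈ T.toFinset, ((T.count e - T.count (e.1, !e.2) : ℕ) : ℤ) * termVal x e := by
    have h : ∀ l : List (Term × List Term),
        weightedVal x (l.filter fun q => !q.2.isEmpty) = weightedVal x l := by
      intro l
      induction l with
      | nil => rfl
      | cons q l ih =>
        rcases q with ⟨e, _ | ⟨a, s⟩⟩ <;> simp_all [weightedVal]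
    have h' : T.toFinset = (nub T).toFinset := by
      ext e; simp [mem_nub]
    rw [collect, h, h', List.sum_toFinset _ (nodup_nub T), weightedVal, List.map_map]
    congr 1
    refine List.map_congr_left fun e _ => ?_
    simp only [Function.comp_apply, List.length_drop, length_filter_eq_count]
  have h₂ : ∑ e ∈ T.toFinset, ((min (T.count e) (T.count (e.1, !e.2)) : ℕ) : ℤ) * termVal x e = 0 := by
    rw [← Finset.sum_filter_ne_zero]
    have hg : ∀ e : Term, ((min (T.count (e.1, !e.2)) (T.count (e.1, !!e.2)) : ℕ) : ℤ) *
        termVal x (e.1, !e.2) =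
        -(((min (T.count e) (T.count (e.1, !e.2)) : ℕ) : ℤ) * termVal x e) := by
      intro e
      rw [termVal_neg, Bool.not_not, min_comm]; ring
    refine Finset.sum_involution (fun e _ => (e.1, !e.2)) (fun e _ => ?_) (fun e _ _ h => ?_)
      (fun e he => ?_) (fun e _ => by simp)
    · have := hg e
      simp only at *
      rw [this]; ring
    · have := congrArg Prod.snd h
      simp at this
    · rw [Finset.mem_filter] at he ⊢
      refine ⟨?_, ?_⟩
      · have h := left_ne_zero_of_mul he.2
        rw [List.mem_toFinset, ← List.count_pos_iff]
        simp only [ne_eq, Nat.cast_eq_zero] at h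
        omega
      · have := hg e
        simp only at *
        rw [this, neg_ne_zero]
        exact he.2
  rw [h₁, termsVal, Finset.sum_list_map_count, ← add_zero (Finset.sum _ _), ← h₂,
    ← Finset.sum_add_distrib]
  refine Finset.sum_congr rfl fun e _ => ?_
  rw [← add_mul, nsmul_eq_mul, ← Nat.cast_add, tsub_add_min]
  congr!

/-! ### The terms of an instance -/

/-- The list of the constraints of an instance, as it is encoded. -/
def CSP.raw {r : ℕ} (I : CSP r) : List (List ℕ × BTree) :=
  I.constraints.map fun c => (c.vars.map Fin.val, encTable c.vars.length c.table)

theorem encList_map {α β : Type} (e : β → BTree) (f : α → β) (l : List α) :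
    encList e (l.map f) = encList (fun a => e (f a)) l := by
  induction l with
  | nil => rfl
  | cons a l ih => rw [List.map_cons, encList, encList, ih]

/-- The proof fields of an instance leave no trace in its tree, so programs may work with plain
lists of numbers. -/
theorem CSP.enc_raw {r : ℕ} (I : CSP r) (k : ℕ) :
    (MaxCSP r).code I k = TreeEnc.enc ((I.numVars, I.raw), k) := by
  have h : CSP.enc I = TreeEnc.enc (I.numVars, I.raw) := by
    simp only [CSP.enc, TreeEnc.enc, CSP.raw, encList_map]
    rfl
  change BTree.cons (CSP.enc I) (encNat k) = _
  rw [h]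
  rfl

section
variable {r : ℕ} (I : CSP r)

theorem CSP.termsVal_allTerms (x : ℕ → Bool) :
    termsVal x (allTerms r I.raw) = 2 ^ r * I.numSat fun i => x i := by
  rw [allTerms, CSP.raw, CSP.numSat]
  induction I.constraints with
  | nil => simp [termsVal]
  | cons c l ih =>
    rw [List.map_cons, List.flatMap_cons, termsVal_append, ih,
      termsVal_expand _ _ _ _ _ (by simp) c.length_le, List.countP_cons]
    have : (c.table fun j => x ((c.vars.map Fin.val).getD j 0)) = c.eval fun i => x i := by
      rw [Constraint.eval]
      congr 1
      funext j
      rw [List.getD_eq_getElem _ _ (by simp)]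
      simp
    rw [this]
    split_ifs <;> push_cast <;> ring

theorem CSP.mem_nonconstTerms {e : Term} (he : e ∈ nonconstTerms r I.raw) :
    e.1 ≠ [] ∧ e.1.Nodup ∧ e.1.length ≤ r ∧ ∀ v ∈ e.1, v < I.numVars := by
  rw [nonconstTerms, List.mem_filter, allTerms, List.mem_flatMap] at he
  obtain ⟨⟨c', hc', he⟩, h⟩ := he
  obtain ⟨c, -, rfl⟩ := List.mem_map.1 hc'
  have hs := sublist_of_mem_expand he
  refine ⟨by simpa using h, hs.nodup (c.nodup.map Fin.val_injective), ?_, fun v hv => ?_⟩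
  · exact hs.length_le.trans (by simpa using c.length_le)
  · obtain ⟨i, -, rfl⟩ := List.mem_map.1 (hs.subset hv)
    exact i.2

/-- An assignment to the variables of an instance, as an assignment to all numbers. -/
def extendAssignment {n : ℕ} (x : Fin n → Bool) (v : ℕ) : Bool :=
  if h : v < n then x ⟨v, h⟩ else false

/-- Flipping the value of one variable of the term is a bijection of assignments that negates the
term. -/
theorem sum_termVal_eq_zero {n : ℕ} {e : Term} (h₀ : e.1 ≠ []) (h₁ : e.1.Nodup)
    (h₂ : ∀ v ∈ e.1, v < n) : ∑ x : Fin n → Bool, termVal (extendAssignment x) e = 0 := by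
  rcases e with ⟨_ | ⟨v, vs⟩, b⟩
  · exact absurd rfl h₀
  have hv : v < n := h₂ v (by simp)
  have hvs : v ∉ vs := (List.nodup_cons.1 h₁).1
  let g : (Fin n → Bool) → (Fin n → Bool) := fun x => Function.update x ⟨v, hv⟩ !x ⟨v, hv⟩
  have hg : Function.Involutive g := fun x => by simp [g]
  have h : ∑ x : Fin n → Bool, termVal (extendAssignment x) (v :: vs, b) =
      ∑ x : Fin n → Bool, -termVal (extendAssignment x) (v :: vs, b) := by
    refine Fintype.sum_equiv hg.toPerm _ _ fun x => ?_
    have h₃ : ∀ u ∈ vs, extendAssignment (g x) u = extendAssignment x u := by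
      intro u hu
      have : u ≠ v := by rintro rfl; exact hvs hu
      unfold extendAssignment
      split_ifs
      · simp [g, this]
      · rfl
    have h₄ : extendAssignment (g x) v = !extendAssignment x v := by
      simp [extendAssignment, hv, g]
    simp only [Function.Involutive.coe_toPerm, termVal, List.map_cons, List.prod_cons]
    rw [List.map_congr_left (l := vs) (f := fun v => sg (extendAssignment (g x) v))
      fun u hu => by rw [h₃ u hu], h₄, sg_not]
    ring
  rw [Finset.sum_neg_distrib] at h
  omega

/-- The constant terms add up to some `C`, and the others have mean zero, so the average is `C / 2 ^
r`. After scaling by `2 ^ r` the threshold above the average is exactly `k`. -/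
theorem CSP.yes_iff_termsVal (k : ℕ) :
    (MaxCSP r).Yes I k ↔ ∃ x : ℕ → Bool, (k : ℤ) ≤ termsVal x (nonconstTerms r I.raw) := by
  set T := nonconstTerms r I.raw with hT
  obtain ⟨C, hC⟩ : ∃ C : ℤ, ∀ x : ℕ → Bool, 2 ^ r * (I.numSat fun i => x i : ℤ) =
      C + termsVal x T := by
    refine ⟨(((allTerms r I.raw).filter fun e => e.1.isEmpty).map fun e => sg e.2).sum, fun x => ?_⟩
    rw [← I.termsVal_allTerms, hT, nonconstTerms]
    induction allTerms r I.raw with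
    | nil => rfl
    | cons e l ih =>
      rcases e with ⟨_ | ⟨v, vs⟩, b⟩
      · have h : termVal x ([], b) = sg b := by simp [termVal]
        simp only [termsVal] at *
        simp [ih, h]; ring
      · simp only [termsVal] at *
        simp [ih]; ring
  have hext : ∀ x : Fin I.numVars → Bool, (fun i : Fin I.numVars => extendAssignment x i) = x := by
    intro x; funext i; simp [extendAssignment]
  have hsum : ∑ x : Fin I.numVars → Bool, termsVal (extendAssignment x) T = 0 := by
    have h : ∀ l : List Term, (∀ e ∈ l, e ∈ T) →
        ∑ x : Fin I.numVars → Bool, termsVal (extendAssignment x) l = 0 := by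
      intro l
      induction l with
      | nil => simp [termsVal]
      | cons e l ih =>
        intro hl
        obtain ⟨h₁, h₂, -, h₃⟩ := I.mem_nonconstTerms (hl e (by simp))
        have h₄ := ih fun e he => hl e (List.mem_cons_of_mem _ he)
        simp only [termsVal, List.map_cons, List.sum_cons, Finset.sum_add_distrib] at *
        rw [h₄, sum_termVal_eq_zero h₁ h₂ h₃, add_zero]
    exact h T fun _ he => he
  have havg : I.average = C / 2 ^ r := by
    have h : (2 ^ r : ℤ) * ∑ x : Fin I.numVars → Bool, (I.numSat x : ℤ) = 2 ^ I.numVars * C := by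
      rw [Finset.mul_sum]
      calc ∑ x : Fin I.numVars → Bool, 2 ^ r * (I.numSat x : ℤ)
          = ∑ x : Fin I.numVars → Bool, (C + termsVal (extendAssignment x) T) :=
            Finset.sum_congr rfl fun x _ => by rw [← hC, hext]
        _ = 2 ^ I.numVars * C := by
            rw [Finset.sum_add_distrib, hsum]; simp
    have h' : (2 ^ r : ℚ) * ∑ x : Fin I.numVars → Bool, (I.numSat x : ℚ) = 2 ^ I.numVars * C := by
      exact_mod_cast h
    rw [CSP.average, div_eq_div_iff (by positivity) (by positivity)]
    linarith
  have hkey : ∀ x : ℕ → Bool, I.average + (k : ℚ) / 2 ^ r ≤ (I.numSat fun i => x i) ↔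
      (k : ℤ) ≤ termsVal x T := by
    intro x
    rw [havg, ← add_div, div_le_iff₀ (by positivity)]
    have h : (2 ^ r : ℚ) * (I.numSat fun i => x i : ℚ) = C + termsVal x T := by
      exact_mod_cast hC x
    rw [mul_comm, h, add_le_add_iff_left]
    exact_mod_cast Iff.rfl
  constructor
  · rintro ⟨x, hx⟩
    exact ⟨extendAssignment x, (hkey _).1 (by rwa [hext])⟩
  · rintro ⟨x, hx⟩
    exact ⟨fun i => x i, (hkey x).2 hx⟩

theorem CSP.yes_iff_weightedVal (k : ℕ) :
    (MaxCSP r).Yes I k ↔ ∃ x : ℕ → Bool, (k : ℤ) ≤ weightedVal x (reduced r I.raw) := by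
  rw [I.yes_iff_termsVal]
  simp_rw [reduced, weightedVal_collect,
    termsVal_canonTerms _ fun e he => (I.mem_nonconstTerms he).2.1]

/-- Weighted terms that stand for the equations of a system without repeated left-hand sides. -/
structure ReducedTerms (r : ℕ) (E : List (Term × List Term)) : Prop where
  nodup : E.Nodup
  eq_of_vars : ∀ q ∈ E, ∀ q' ∈ E, (∀ v, v ∈ q.1.1 ↔ v ∈ q'.1.1) → q = q'
  vars_nodup : ∀ q ∈ E, q.1.1.Nodup
  vars_ne_nil : ∀ q ∈ E, q.1.1 ≠ []
  length_le : ∀ q ∈ E, q.1.1.length ≤ r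
  weight_pos : ∀ q ∈ E, 0 < q.2.length

theorem CSP.reducedTerms : ReducedTerms r (reduced r I.raw) := by
  have hcan : ∀ q ∈ reduced r I.raw, ∃ e ∈ nonconstTerms r I.raw, q.1.1.Perm e.1 := by
    intro q hq
    obtain ⟨e, he, h⟩ := mem_canonTerms (mem_collect hq).1
    refine ⟨e, he, ?_⟩
    rw [h]
    exact perm_canon he (I.mem_nonconstTerms he).2.1
  refine ⟨?_, ?_, ?_, ?_, ?_, ?_⟩
  · rw [reduced, collect]
    exact ((nodup_nub _).map fun e e' h => congrArg Prod.fst h).filter _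
  · intro q hq q' hq' h
    have h₁ := mem_collect hq
    have h₂ := mem_collect hq'
    have h₃ := canonTerms_eq h₁.1 h₂.1 h
    have h₄ : q.1 = q'.1 := by
      refine Prod.ext h₃ ?_
      -- Two terms that differ only in sign cannot both survive, since one of the two truncated
      -- differences of their multiplicities is zero.
      by_contra hne
      have h₅ : q'.1 = (q.1.1, !q.1.2) := Prod.ext h₃.symm (by
        cases h₆ : q.1.2 <;> cases h₇ : q'.1.2 <;> simp_all)
      have h₆ := h₁.2.2.1
      have h₇ := h₂.2.2.1
      rw [h₅] at h₇
      simp only [Bool.not_not, Prod.mk.eta] at h₇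
      have h₈ := List.length_pos_of_ne_nil h₁.2.1
      have h₉ := List.length_pos_of_ne_nil h₂.2.1
      omega
    refine Prod.ext h₄ ?_
    rw [h₁.2.2.2, h₂.2.2.2, h₄]
  · intro q hq
    obtain ⟨e, he, h⟩ := hcan q hq
    exact h.nodup_iff.2 (I.mem_nonconstTerms he).2.1
  · intro q hq hnil
    obtain ⟨e, he, h⟩ := hcan q hq
    rw [hnil] at h
    exact (I.mem_nonconstTerms he).1 h.symm.eq_nil
  · intro q hq
    obtain ⟨e, he, h⟩ := hcan q hq
    exact h.length_eq ▸ (I.mem_nonconstTerms he).2.2.1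
  · intro q hq
    exact List.length_pos_of_ne_nil (mem_collect hq).2.1

end

/-! ### Systems of equations without repeated left-hand sides -/

/-- The indicator vector of a list. -/
def indVec {n : ℕ} (l : List (Fin n)) : Fin n → ZMod 2 := fun i => if i ∈ l then 1 else 0

theorem indVec_dotProduct {n : ℕ} {l : List (Fin n)} (hl : l.Nodup) (z : Fin n → ZMod 2) :
    indVec l ⬝ᵥ z = (l.map z).sum := by
  rw [← List.sum_toFinset _ hl, dotProduct]
  simp only [indVec, ite_mul, one_mul, zero_mul, ← List.mem_toFinset, Finset.sum_ite_mem,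
    Finset.univ_inter]

theorem hammingNorm_indVec_le {n : ℕ} (l : List (Fin n)) : hammingNorm (indVec l) ≤ l.length := by
  refine le_trans (Finset.card_le_card (t := l.toFinset) fun i hi => ?_) l.toFinset_card_le
  by_contra h
  simp_all [indVec]

theorem sgn_mul_sgn (a b : ZMod 2) : sgn a * sgn b = if a = b then 1 else -1 := by
  revert a b; decide

theorem sgn_sum (l : List (ZMod 2)) : sgn l.sum = (l.map sgn).prod := by
  induction l with
  | nil => rfl
  | cons a l ih => rw [List.sum_cons, sgn_add, ih, List.map_cons, List.prod_cons]

theorem sum_map_ite_eq {α β : Type} [DecidableEq β] {l : List α} {f : α → β} (g : α → ℤ)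
    (hl : (l.map f).Nodup) {a : α} (ha : a ∈ l) :
    (l.map fun b => if f b = f a then g b else 0).sum = g a := by
  induction l with
  | nil => simp at ha
  | cons b l ih =>
    rw [List.map_cons, List.nodup_cons] at hl
    rw [List.map_cons, List.sum_cons]
    rcases List.mem_cons.1 ha with rfl | ha
    · rw [if_pos rfl, List.sum_eq_zero, add_zero]
      intro x hx
      obtain ⟨c, hc, rfl⟩ := List.mem_map.1 hx
      rw [if_neg]
      intro h
      exact hl.1 (h ▸ List.mem_map_of_mem hc)
    · rw [ih hl.2 ha, if_neg, zero_add]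
      intro h
      exact hl.1 (h ▸ List.mem_map_of_mem ha)

namespace LinSystem

variable {r : ℕ} (S : LinSystem r)

/-- The coefficient of a character in the excess. -/
def coeff (t : Fin S.numVars → ZMod 2) : ℤ :=
  (S.equations.map fun e => if indVec e.vars = t then sgn e.rhs * e.weight else 0).sum

theorem excess_eq (z : Fin S.numVars → ZMod 2) : S.excess z =
    (S.equations.map fun e => sgn e.rhs * e.weight * (e.vars.map fun i => sgn (z i)).prod).sum := by
  rw [excess]
  congr 1
  refine List.map_congr_left fun e _ => ?_
  have h := sgn_sum (e.vars.map z)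
  rw [List.map_map] at h
  rw [show (e.vars.map fun i => sgn (z i)) = e.vars.map (sgn ∘ z) from rfl, ← h, mul_right_comm,
    mul_comm (sgn _), sgn_mul_sgn]
  by_cases h : (e.vars.map z).sum = e.rhs
  · rw [if_pos (show e.Satisfied z from h), if_pos h, one_mul]
  · rw [if_neg (show ¬e.Satisfied z from h), if_neg h, neg_one_mul]

theorem excess_eq_sum (z : Fin S.numVars → ZMod 2) :
    S.excess z = ∑ t, S.coeff t * chi t z := by
  have h : ∀ e : LinEquation r S.numVars, (e.vars.map fun i => sgn (z i)).prod =
      chi (indVec e.vars) z := by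
    intro e
    rw [chi, indVec_dotProduct e.nodup, sgn_sum, List.map_map]
    rfl
  rw [excess_eq]
  simp only [coeff, h]
  induction S.equations with
  | nil => simp
  | cons e l ih =>
    simp only [List.map_cons, List.sum_cons, add_mul, Finset.sum_add_distrib, ← ih, ite_mul,
      zero_mul, Finset.sum_ite_eq, Finset.mem_univ, if_true]

theorem exists_of_coeff_ne_zero {t : Fin S.numVars → ZMod 2} (ht : S.coeff t ≠ 0) :
    ∃ e ∈ S.equations, indVec e.vars = t := by
  by_contra! h
  refine ht (List.sum_eq_zero fun x hx => ?_)
  obtain ⟨e, he, rfl⟩ := List.mem_map.1 hx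
  rw [if_neg (h e he)]

theorem coeff_zero (h : ∀ e ∈ S.equations, e.vars ≠ []) : S.coeff 0 = 0 := by
  by_contra h'
  obtain ⟨e, he, h''⟩ := S.exists_of_coeff_ne_zero h'
  obtain ⟨v, hv⟩ := List.exists_mem_of_ne_nil _ (h e he)
  have := congrFun h'' v
  simp [indVec, hv] at this

theorem coeff_indVec (h : (S.equations.map fun e => indVec e.vars).Nodup)
    {e : LinEquation r S.numVars} (he : e ∈ S.equations) :
    S.coeff (indVec e.vars) = sgn e.rhs * e.weight :=
  sum_map_ite_eq (fun e : LinEquation r S.numVars => sgn e.rhs * (e.weight : ℤ)) h he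

theorem exists_weight_le_excess (h : ∀ e ∈ S.equations, e.vars ≠ [])
    (h' : (S.equations.map fun e => indVec e.vars).Nodup)
    {e : LinEquation r S.numVars} (he : e ∈ S.equations) : ∃ z, (e.weight : ℤ) ≤ S.excess z := by
  obtain ⟨z, hz⟩ := exists_abs_le S.coeff (S.coeff_zero h) (indVec e.vars)
  refine ⟨z, ?_⟩
  rw [excess_eq_sum]
  refine le_trans ?_ hz
  rw [S.coeff_indVec h' he, abs_mul, Nat.abs_cast]
  unfold sgn
  split_ifs <;> simp

theorem exists_le_excess_of_lt_numVars (h : ∀ e ∈ S.equations, e.vars ≠ [])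
    (h' : (S.equations.map fun e => indVec e.vars).Nodup)
    (hS : ∀ i, ∃ e ∈ S.equations, i ∈ e.vars) {k : ℕ} (hk : 2 * r * k < S.numVars) :
    ∃ z, (k : ℤ) ≤ S.excess z := by
  simp_rw [excess_eq_sum]
  refine exists_le_of_lt_card S.coeff (S.coeff_zero h) r k (fun s hs => ?_) (fun i => ?_)
    (by simpa using hk)
  · obtain ⟨e, -, rfl⟩ := S.exists_of_coeff_ne_zero hs
    exact (hammingNorm_indVec_le _).trans e.length_le
  · obtain ⟨e, he, hi⟩ := hS i
    refine ⟨indVec e.vars, ?_, by simp [indVec, hi]⟩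
    rw [S.coeff_indVec h' he]
    have := e.weight_pos
    unfold sgn
    split_ifs <;> simp <;> omega

end LinSystem

theorem mem_suppVars {E : List (Term × List Term)} {v : ℕ} :
    v ∈ suppVars E ↔ ∃ q ∈ E, v ∈ q.1.1 := by
  rw [suppVars, mem_nub, List.mem_flatMap]

/-- The system of equations of reduced terms, with the variables renumbered. -/
def ReducedTerms.system {r : ℕ} {E : List (Term × List Term)} (h : ReducedTerms r E) :
    LinSystem r where
  numVars := (suppVars E).length
  equations := E.attach.map fun q =>
    { vars := q.1.1.1.attach.map fun v => ⟨(suppVars E).idxOf v.1,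
        List.idxOf_lt_length_of_mem (mem_suppVars.2 ⟨q.1, q.2, v.2⟩)⟩
      nodup := (List.nodup_attach.2 (h.vars_nodup q.1 q.2)).map fun v w hvw => Subtype.ext
        ((List.idxOf_inj (mem_suppVars.2 ⟨q.1, q.2, v.2⟩)).1 (congrArg Fin.val hvw))
      length_le := by simpa using h.length_le q.1 q.2
      rhs := if q.1.1.2 then 1 else 0
      weight := q.1.2.length
      weight_pos := h.weight_pos q.1 q.2 }

namespace ReducedTerms
variable {r : ℕ} {E : List (Term × List Term)} (h : ReducedTerms r E)

theorem enc_system : LinSystem.enc h.system = enc ((suppVars E).length, relabel E) := by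
  have h₁ : relabel E = E.attach.map fun q =>
      (q.1.1.1.map fun v => (suppVars E).idxOf v, (if q.1.1.2 then 1 else 0), q.1.2.length) :=
    (List.attach_map_val (l := E) (f := fun q => (q.1.1.map fun v => (suppVars E).idxOf v,
      (if q.1.2 then 1 else 0), q.2.length))).symm
  rw [h₁]
  simp only [LinSystem.enc, system, enc, encList_map]
  congr 2
  funext q
  simp only [LinEquation.enc, encList_map]
  congr 1
  · conv_rhs => rw [← List.attach_map_subtype_val q.1.1.1, encList_map]
  · split_ifs <;> rfl

theorem mem_vars {q : Term × List Term} (hq : q ∈ E) (i : Fin (suppVars E).length) :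
    i ∈ (q.1.1.attach.map fun v => (⟨(suppVars E).idxOf v.1,
        List.idxOf_lt_length_of_mem (mem_suppVars.2 ⟨q, hq, v.2⟩)⟩ : Fin (suppVars E).length)) ↔
      (suppVars E)[i] ∈ q.1.1 := by
  rw [List.mem_map]
  constructor
  · rintro ⟨v, -, rfl⟩
    have := v.2
    simpa
  · intro hi
    refine ⟨⟨_, hi⟩, List.mem_attach _ _, Fin.ext ?_⟩
    exact List.Nodup.idxOf_getElem (nodup_nub _) _ _

theorem system_vars_ne_nil : ∀ e ∈ h.system.equations, e.vars ≠ [] := by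
  intro e he
  obtain ⟨q, -, rfl⟩ := List.mem_map.1 he
  exact fun h' => h.vars_ne_nil q.1 q.2 (List.attach_eq_nil_iff.1 (List.map_eq_nil_iff.1 h'))

theorem system_nodup : (h.system.equations.map fun e => indVec e.vars).Nodup := by
  rw [system, List.map_map]
  refine List.Nodup.map_on (fun q _ q' _ hqq' => Subtype.ext ?_) (List.nodup_attach.2 h.nodup)
  refine h.eq_of_vars q.1 q.2 q'.1 q'.2 fun v => ?_
  have key : ∀ i : Fin (suppVars E).length,
      (suppVars E)[i] ∈ q.1.1.1 ↔ (suppVars E)[i] ∈ q'.1.1.1 := by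
    intro i
    rw [← mem_vars q.2, ← mem_vars q'.2]
    have := congrFun hqq' i
    simp only [Function.comp_apply, indVec] at this
    split_ifs at this with h₁ h₂ h₂
    · exact iff_of_true h₁ h₂
    · simp at this
    · simp at this
    · exact iff_of_false h₁ h₂
  by_cases hv : v ∈ suppVars E
  · have := key ⟨(suppVars E).idxOf v, List.idxOf_lt_length_of_mem hv⟩
    simpa using this
  · exact iff_of_false (fun h' => hv (mem_suppVars.2 ⟨q.1, q.2, h'⟩))
      fun h' => hv (mem_suppVars.2 ⟨q'.1, q'.2, h'⟩)

theorem system_vars_occur : ∀ i, ∃ e ∈ h.system.equations, i ∈ e.vars := by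
  intro i
  have hi : (suppVars E)[i] ∈ suppVars E := List.getElem_mem _
  obtain ⟨q, hq, hv⟩ := mem_suppVars.1 hi
  exact ⟨_, List.mem_map_of_mem (List.mem_attach E ⟨q, hq⟩), (mem_vars hq i).2 hv⟩

theorem sg_decide (a : ZMod 2) : sg (decide (a = 1)) = sgn a := by revert a; decide

theorem excess_system (x : ℕ → Bool) (z : Fin h.system.numVars → ZMod 2)
    (hxz : ∀ v (hv : v ∈ suppVars E),
      x v = decide (z ⟨(suppVars E).idxOf v, List.idxOf_lt_length_of_mem hv⟩ = 1)) :
    h.system.excess z = weightedVal x E := by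
  rw [LinSystem.excess_eq, weightedVal, ← List.attach_map_val (l := E)]
  refine congrArg List.sum ((List.map_map ..).trans (List.map_congr_left fun q _ => ?_))
  have h₁ : ((q.1.1.1.attach.map fun v => (⟨(suppVars E).idxOf v.1, List.idxOf_lt_length_of_mem
      (mem_suppVars.2 ⟨q.1, q.2, v.2⟩)⟩ : Fin h.system.numVars)).map fun i => sgn (z i)) =
      q.1.1.1.map fun v => sg (x v) := by
    rw [← List.attach_map_val (l := q.1.1.1), List.map_map]
    refine List.map_congr_left fun v _ => ?_
    rw [hxz v.1 (mem_suppVars.2 ⟨q.1, q.2, v.2⟩), sg_decide]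
    rfl
  have h₂ : sgn (if q.1.1.2 then 1 else 0) = sg q.1.1.2 := by
    cases q.1.1.2 <;> rfl
  have h₃ := congrArg List.prod h₁
  calc _ = sgn (if q.1.1.2 then 1 else 0) * (q.1.2.length : ℤ) *
        (q.1.1.1.map fun v => sg (x v)).prod := congrArg _ h₃
    _ = _ := by rw [h₂, termVal]; ring

theorem exists_excess_iff (k : ℕ) :
    (∃ z, (k : ℤ) ≤ h.system.excess z) ↔ ∃ x : ℕ → Bool, (k : ℤ) ≤ weightedVal x E := by
  constructor
  · rintro ⟨z, hz⟩
    refine ⟨fun v => if hv : v ∈ suppVars E then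
      decide (z ⟨(suppVars E).idxOf v, List.idxOf_lt_length_of_mem hv⟩ = 1) else false, ?_⟩
    rwa [← h.excess_system _ z fun v hv => by rw [dif_pos hv]]
  · rintro ⟨x, hx⟩
    refine ⟨fun i => if x ((suppVars E)[i.val]'i.2) then 1 else 0, ?_⟩
    rwa [h.excess_system x _ fun v hv => ?_]
    have h₁ := List.getElem_idxOf (List.idxOf_lt_length_of_mem hv)
    have h₂ : x v = decide ((if x v then (1 : ZMod 2) else 0) = 1) := by cases x v <;> rfl
    conv_rhs at h₂ => rw [← h₁]
    exact h₂

end ReducedTerms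

theorem length_copies {τ : Type} (n : ℕ) (l : List τ) : (copies n l).length = n * l.length := by
  induction n with
  | zero => simp [copies]
  | succ n ih => rw [copies, List.length_append, ih]; ring

/-- The test uses `min k n` in place of `k`, where `n` is the number of variables. This is harmless:
if `k ≥ n`, then `n` exceeds neither `2 * r * k` nor `2 * r * n`, as `r` is positive. -/
theorem isLarge_iff {r : ℕ} (hr : 0 < r) (E : List (Term × List Term)) (k : ℕ) :
    isLarge r E k = true ↔
      (∃ q ∈ E, k ≤ q.2.length) ∨ 2 * r * k < (suppVars E).length := by
  rw [isLarge, Bool.or_eq_true, List.any_eq_true]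
  simp only [decide_eq_true_eq, Bool.not_eq_true', List.isEmpty_eq_false_iff, ne_eq,
    List.drop_eq_nil_iff, length_copies, length_cut, not_le]
  refine or_congr Iff.rfl ?_
  rcases le_total k (suppVars E).length with h | h
  · rw [min_eq_left h]
  · rw [min_eq_right h]
    have h₁ : 1 * (suppVars E).length ≤ 2 * r * (suppVars E).length :=
      Nat.mul_le_mul_right _ (by omega)
    have h₂ : 2 * r * (suppVars E).length ≤ 2 * r * k := Nat.mul_le_mul_left _ h
    omega

theorem CSP.yes_iff_system {r : ℕ} (I : CSP r) (k : ℕ) :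
    (MaxCSP r).Yes I k ↔ ∃ z, (k : ℤ) ≤ I.reducedTerms.system.excess z := by
  rw [I.yes_iff_weightedVal, I.reducedTerms.exists_excess_iff]

theorem CSP.yes_of_isLarge {r : ℕ} (hr : 0 < r) (I : CSP r) (k : ℕ)
    (h : isLarge r (reduced r I.raw) k = true) : (MaxCSP r).Yes I k := by
  rw [I.yes_iff_system]
  have h₁ := I.reducedTerms.system_vars_ne_nil
  have h₂ := I.reducedTerms.system_nodup
  rcases (isLarge_iff hr _ _).1 h with ⟨q, hq, hk⟩ | hk
  · obtain ⟨z, hz⟩ := LinSystem.exists_weight_le_excess _ h₁ h₂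
      (List.mem_map_of_mem (List.mem_attach _ ⟨q, hq⟩))
    exact ⟨z, le_trans (by exact_mod_cast hk) hz⟩
  · exact LinSystem.exists_le_excess_of_lt_numVars _ h₁ h₂ I.reducedTerms.system_vars_occur hk

/-! ### The bikernelization -/

/-- The bikernelization from Max `r`-CSP to Max `r`-Lin AA. -/
def kernel {r : ℕ} (I : CSP r) (k : ℕ) : LinSystem r × ℕ :=
  if isLarge r (reduced r I.raw) k then (⟨0, []⟩, 0) else (I.reducedTerms.system, k)

theorem kernel_cases {r : ℕ} (I : CSP r) (k : ℕ) :
    isLarge r (reduced r I.raw) k = true ∧ kernel I k = (⟨0, []⟩, 0) ∨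
      ¬isLarge r (reduced r I.raw) k = true ∧ kernel I k = (I.reducedTerms.system, k) := by
  by_cases h : isLarge r (reduced r I.raw) k = true
  · exact .inl ⟨h, if_pos h⟩
  · exact .inr ⟨h, if_neg h⟩

theorem code_kernel {r : ℕ} (I : CSP r) (k : ℕ) :
    (MaxLinAA r).code (kernel I k).1 (kernel I k).2 =
      enc (rawKernel r ((I.numVars, I.raw), k)) := by
  change BTree.cons (LinSystem.enc (kernel I k).1) (encNat (kernel I k).2) = _
  rw [kernel, rawKernel]
  split_ifs with h
  · rfl
  · rw [ReducedTerms.enc_system]; rfl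

theorem polyTime_kernel (r : ℕ) : ∃ (p : Prog) (P : Polynomial ℕ), ∀ (I : CSP r) (k : ℕ),
    ∃ t ≤ P.eval ((MaxCSP r).code I k).size,
      p.Runs ((MaxCSP r).code I k) ((MaxLinAA r).code (kernel I k).1 (kernel I k).2) t := by
  obtain ⟨p, P, h⟩ := PolyTime.rawKernel r
  refine ⟨p, P, fun I k => ?_⟩
  rw [I.enc_raw, code_kernel]
  exact h _

theorem yes_kernel_iff {r : ℕ} (hr : 0 < r) (I : CSP r) (k : ℕ) :
    (MaxCSP r).Yes I k ↔ (MaxLinAA r).Yes (kernel I k).1 (kernel I k).2 := by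
  rw [kernel]
  split_ifs with h
  · exact iff_of_true (I.yes_of_isLarge hr k h) ⟨0, by simp [LinSystem.excess]⟩
  · exact I.yes_iff_system k

theorem numVars_kernel_le {r : ℕ} (hr : 0 < r) (I : CSP r) (k : ℕ) :
    (kernel I k).1.numVars ≤ 2 * r * k := by
  rw [kernel]
  split_ifs with h
  · simp
  · rw [isLarge_iff hr, not_or] at h
    exact not_lt.1 h.2

theorem encNat_size_le (n : ℕ) : (encNat n).size ≤ 4 * n + 1 := tsize_nat_le n

theorem encList_size_le {α : Type} {e : α → BTree} {l : List α} {B m : ℕ}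
    (h : ∀ a ∈ l, (e a).size ≤ B) (hm : l.length ≤ m) :
    (encList e l).size ≤ m * (B + 1) + 1 := by
  have h' : (encList e l).size ≤ l.length * (B + 1) + 1 := by
    induction l with
    | nil => simp [encList, BTree.size]
    | cons a l ih =>
      have h₁ := h a (by simp)
      have h₂ := ih (fun b hb => h b (List.mem_cons_of_mem _ hb))
        (by rw [List.length_cons] at hm; omega)
      rw [encList, BTree.size, List.length_cons, Nat.succ_mul]
      omega
  exact h'.trans (Nat.succ_le_succ (Nat.mul_le_mul_right _ hm))

theorem encVars_size_le {n r : ℕ} (l : List (Fin n)) (hl : l.length ≤ r) :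
    (encList (fun i : Fin n => encNat i) l).size ≤ r * (4 * n + 2) + 1 :=
  encList_size_le (B := 4 * n + 1) (fun i _ => (encNat_size_le i).trans (by omega)) hl

/-- Distinct left-hand sides are distinct vectors over `𝔽₂`, so there are at most `2 ^ n` equations,
each with a tree bounded in terms of `r`, `n` and `k`. -/
theorem LinSystem.enc_size_le {r n k : ℕ} (S : LinSystem r) (hn : S.numVars ≤ n)
    (hS : (S.equations.map fun e => indVec e.vars).Nodup)
    (hk : ∀ e ∈ S.equations, e.weight ≤ k) :
    (LinSystem.enc S).size ≤ 4 * n + 1 + (2 ^ n * (r * (4 * n + 2) + 4 * k + 10 + 1) + 1) + 1 := by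
  have h₁ : S.equations.length ≤ 2 ^ n := by
    have := hS.length_le_card
    rw [List.length_map] at this
    refine this.trans ?_
    simpa [ZMod.card] using Nat.pow_le_pow_right (by norm_num) hn
  have h₂ := encList_size_le (e := LinEquation.enc) (l := S.equations)
    (B := r * (4 * n + 2) + 4 * k + 10) (fun e he => by
      have h₁ := encVars_size_le e.vars e.length_le
      have h₂ := encNat_size_le e.rhs.val
      have h₃ := encNat_size_le e.weight
      have h₄ := ZMod.val_lt e.rhs
      have h₅ := hk e he
      have h₆ : r * (4 * S.numVars + 2) ≤ r * (4 * n + 2) := Nat.mul_le_mul_left _ (by omega)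
      simp only [LinEquation.enc, BTree.size]
      omega) h₁
  have h₃ := encNat_size_le S.numVars
  simp only [LinSystem.enc, BTree.size]
  omega

theorem enc_kernel_size_le {r : ℕ} (hr : 0 < r) (I : CSP r) (k : ℕ) :
    (LinSystem.enc (kernel I k).1).size ≤ 4 * (2 * r * k) + 1 +
      (2 ^ (2 * r * k) * (r * (4 * (2 * r * k) + 2) + 4 * k + 10 + 1) + 1) + 1 := by
  refine LinSystem.enc_size_le _ (numVars_kernel_le hr I k) ?_ ?_
  · rcases kernel_cases I k with ⟨-, h⟩ | ⟨-, h⟩ <;> rw [h]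
    · exact List.nodup_nil
    · exact I.reducedTerms.system_nodup
  · rcases kernel_cases I k with ⟨-, h⟩ | ⟨hl, h⟩ <;> rw [h]
    · simp
    · intro e he
      obtain ⟨q, -, rfl⟩ := List.mem_map.1 he
      rw [isLarge_iff hr, not_or] at hl
      by_contra hq
      exact hl.1 ⟨q.1, q.2, (not_le.1 hq).le⟩

theorem isBikernelization_kernel {r : ℕ} (hr : 0 < r) :
    IsBikernelization (MaxCSP r) (MaxLinAA r) (kernel (r := r)) := by
  refine ⟨polyTime_kernel r, yes_kernel_iff hr, ⟨fun k => k, fun I k => ?_⟩,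
    ⟨_, enc_kernel_size_le hr⟩⟩
  rcases kernel_cases I k with ⟨-, h⟩ | ⟨-, h⟩ <;> simp [h]

/-! ### Exhaustive search -/

theorem exists_mem_sublistsOf (x : ℕ → Bool) (l : List ℕ) :
    ∃ A ∈ sublistsOf l, ∀ v, v ∈ A ↔ v ∈ l ∧ x v = true := by
  suffices h : ∀ (l : List ℕ) (s : List (List ℕ)) (B : List ℕ), B ∈ s →
      ∃ A ∈ l.foldl (fun s v => s ++ s.map fun A => v :: A) s,
        ∀ v, v ∈ A ↔ v ∈ B ∨ v ∈ l ∧ x v = true by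
    obtain ⟨A, hA, h⟩ := h l [[]] [] (by simp)
    exact ⟨A, hA, fun v => by simp [h]⟩
  intro l
  induction l with
  | nil => intro s B hB; exact ⟨B, hB, by simp⟩
  | cons u l ih =>
    intro s B hB
    cases hu : x u
    · obtain ⟨A, hA, h⟩ := ih (s ++ s.map fun A => u :: A) B (by simp [hB])
      refine ⟨A, hA, fun v => ?_⟩
      rw [h, List.mem_cons]
      constructor
      · tauto
      · rintro (h | ⟨rfl | h, h'⟩)
        · exact .inl h
        · simp [hu] at h'
        · exact .inr ⟨h, h'⟩
    · obtain ⟨A, hA, h⟩ := ih (s ++ s.map fun A => u :: A) (u :: B) (by simp [hB])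
      refine ⟨A, hA, fun v => ?_⟩
      rw [h, List.mem_cons, List.mem_cons]
      constructor
      · rintro ((rfl | h) | h) <;> tauto
      · tauto

theorem sg_parity (A : List ℕ) (e : Term) :
    sg (parity A e) = termVal (fun v => decide (v ∈ A)) e := by
  have hx : ∀ b c, sg (b ^^ c) = sg b * sg c := by decide
  suffices h : ∀ (l : List ℕ) (b : Bool), sg (l.foldl (fun b v => b ^^ decide (v ∈ A)) b) =
      sg b * (l.map fun v => sg (decide (v ∈ A))).prod from h e.1 e.2
  intro l
  induction l with
  | nil => simp
  | cons v l ih => intro b; rw [List.foldl_cons, ih, hx, List.map_cons, List.prod_cons, mul_assoc]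

theorem length_sub_length (A : List ℕ) (E : List (Term × List Term)) :
    ((E.flatMap fun q => if parity A q.1 then [] else q.2).length : ℤ) -
      (E.flatMap fun q => if parity A q.1 then q.2 else []).length =
      weightedVal (fun v => decide (v ∈ A)) E := by
  induction E with
  | nil => rfl
  | cons q E ih =>
    have h := sg_parity A q.1
    rw [weightedVal, List.map_cons, List.sum_cons, ← h, ← weightedVal, ← ih]
    simp only [List.flatMap_cons, List.length_append]
    cases parity A q.1 <;> simp [sg] <;> ring

theorem weightedVal_congr {x y : ℕ → Bool} {E : List (Term × List Term)}
    (h : ∀ v ∈ suppVars E, x v = y v) : weightedVal x E = weightedVal y E := by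
  unfold weightedVal
  congr 1
  refine List.map_congr_left fun q hq => ?_
  rw [termVal_congr fun v hv => h v (mem_suppVars.2 ⟨q, hq, hv⟩)]

theorem CSP.yes_iff_search {r : ℕ} (hr : 0 < r) (I : CSP r) (k : ℕ) :
    (isLarge r (reduced r I.raw) k ||
      search k (reduced r I.raw) (sublistsOf (suppVars (reduced r I.raw)))) = true ↔
      (MaxCSP r).Yes I k := by
  cases hl : isLarge r (reduced r I.raw) k with
  | true => simpa using I.yes_of_isLarge hr k hl
  | false =>
    rw [I.yes_iff_weightedVal, Bool.false_or, search, List.any_eq_true]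
    simp only [decide_eq_true_eq, List.length_drop]
    generalize reduced r I.raw = E at *
    have key : ∀ A : List ℕ, k ≤ (E.flatMap fun q => if parity A q.1 then [] else q.2).length -
        (E.flatMap fun q => if parity A q.1 then q.2 else []).length ↔
        (k : ℤ) ≤ weightedVal (fun v => decide (v ∈ A)) E := by
      intro A
      rw [← length_sub_length]
      -- Truncated subtraction cannot tell a negative value from zero, which matters only for `k =
      -- 0`. Every weight then counts as large, so only the empty system gets here.
      rcases Nat.eq_zero_or_pos k with rfl | hk
      · have hE : E = [] := by
          by_contra hE
          obtain ⟨q, hq⟩ := List.exists_mem_of_ne_nil _ hE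
          have := (isLarge_iff hr E 0).2 (.inl ⟨q, hq, Nat.zero_le _⟩)
          rw [hl] at this
          exact absurd this (by simp)
        simp [hE]
      · omega
    simp_rw [key]
    constructor
    · rintro ⟨A, -, hA⟩
      exact ⟨_, hA⟩
    · rintro ⟨x, hx⟩
      obtain ⟨A, hA, h⟩ := exists_mem_sublistsOf x (suppVars E)
      refine ⟨A, hA, ?_⟩
      rwa [weightedVal_congr (y := x) fun v hv => ?_]
      rw [Bool.eq_iff_iff]
      simp [h, hv]

/-- The search takes time polynomial in the size of the input and, if it is performed at all, in the
number of assignments. -/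
theorem search_runs (r : ℕ) : ∃ (p : Prog) (R : Polynomial ℕ),
    ∀ (x : (ℕ × List (List ℕ × BTree)) × ℕ) (M : ℕ),
      (isLarge r (reduced r x.1.2) x.2 = false → 2 ^ (suppVars (reduced r x.1.2)).length ≤ M) →
      ∃ t ≤ R.eval (tsize x + M), p.Runs (enc x) (enc (isLarge r (reduced r x.1.2) x.2 ||
        search x.2 (reduced r x.1.2) (sublistsOf (suppVars (reduced r x.1.2))))) t := by
  have hE : PolyTime fun x : (ℕ × List (List ℕ × BTree)) × ℕ => reduced r x.1.2 :=
    (PolyTime.reduced r).comp (PolyTime.snd.comp PolyTime.fst)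
  have hpre : PolyTime fun x : (ℕ × List (List ℕ × BTree)) × ℕ =>
      (isLarge r (reduced r x.1.2) x.2, (x.2, reduced r x.1.2),
        (x.2, ([[]] : List (List ℕ)), suppVars (reduced r x.1.2))) :=
    ((PolyTime.isLarge r).comp (hE.pair .snd)).pair ((PolyTime.pair .snd hE).pair
      (PolyTime.pair .snd (PolyTime.pair (.const _) (PolyTime.suppVars.comp hE))))
  have hsub : PolyTime fun p : ℕ × List (List ℕ) × ℕ => p.2.1 ++ p.2.1.map fun A => p.2.2 :: A :=
    (PolyTime.fst.comp .snd).append ((PolyTime.fst.comp .snd).map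
      (f := fun p A => p.2.2 :: A) (.cons (.comp .snd (.comp .snd .fst)) .snd))
  have hsch : PolyTime fun p : (ℕ × List (Term × List Term)) × List (List ℕ) =>
      search p.1.1 p.1.2 p.2 :=
    PolyTime.search.comp (.pair (.comp .fst .fst) (.pair (.comp .snd .fst) .snd))
  let γ := Bool × (ℕ × List (Term × List Term)) × ℕ × List (List ℕ) × List ℕ
  have h₁ : PolyTime fun y : γ => y.1 := .fst
  have h₂ : PolyTime fun y : γ => y.2.1 := .comp .fst .snd
  have h₃ : PolyTime fun y : γ => y.2.2 := .comp .snd .snd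
  have h₄ : PolyTime fun _ : γ => true := .const true
  obtain ⟨pre, D, hpre⟩ := hpre
  obtain ⟨sub, U, hsub⟩ := PolyTime.foldl_runs (f := fun (_ : ℕ) (s : List (List ℕ)) v =>
    s ++ s.map fun A => v :: A) hsub
  obtain ⟨sch, W, hsch⟩ := hsch
  obtain ⟨p₁, P₁, h₁⟩ := h₁
  obtain ⟨p₂, P₂, h₂⟩ := h₂
  obtain ⟨p₃, P₃, h₃⟩ := h₃
  obtain ⟨p₄, P₄, h₄⟩ := h₄
  let U' : Polynomial ℕ := U.comp (2 * D + .X * (2 * D + 4))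
  -- The exponential loop stands in the false branch of the test for large instances, so it runs
  -- only when `M` bounds the number of assignments.
  refine ⟨.comp (.branch p₁ p₄ (.comp sch (.pair p₂ (.comp sub p₃)))) pre,
    3 * D + P₁.comp D + P₂.comp D + P₃.comp D + P₄.comp D + U' + W.comp (D + U' + 1) + 10,
    fun x M hM => ?_⟩
  set E := reduced r x.1.2
  obtain ⟨t₀, ht₀, hr₀⟩ := hpre x
  set y : γ := (isLarge r E x.2, (x.2, E), (x.2, ([[]] : List (List ℕ)), suppVars E)) with hy
  set N := tsize x + M
  have hD := eval_le_eval D (show tsize x ≤ N by omega)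
  have hyD : tsize y ≤ D.eval N := (hr₀.size_le.2.trans ht₀).trans hD
  replace hr₀ : pre.Runs (enc x) (enc y) t₀ := hr₀
  obtain ⟨t₁, ht₁, hr₁⟩ := h₁ y
  obtain ⟨t₂, ht₂, hr₂⟩ := h₂ y
  obtain ⟨t₃, ht₃, hr₃⟩ := h₃ y
  obtain ⟨t₄, ht₄, hr₄⟩ := h₄ y
  have e₁ := eval_le_eval P₁ hyD
  have e₂ := eval_le_eval P₂ hyD
  have e₃ := eval_le_eval P₃ hyD
  have e₄ := eval_le_eval P₄ hyD
  have hyD' : (enc y).size ≤ D.eval N := hyD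
  simp only [Polynomial.eval_add, Polynomial.eval_mul, Polynomial.eval_comp, Polynomial.eval_ofNat,
    Polynomial.eval_one]
  cases hl : isLarge r E x.2 with
  | true =>
    have hr₁' : p₁.Runs (enc y) (enc true) t₁ := hl ▸ hr₁
    exact ⟨_, by omega, .comp hr₀ (.branch_true hr₁' hr₄)⟩
  | false =>
    have hr₁' : p₁.Runs (enc y) (enc false) t₁ := hl ▸ hr₁
    have hsize : tsize y = tsize (isLarge r E x.2) + (tsize x.2 + tsize E + 1 +
      (tsize x.2 + (tsize ([[]] : List (List ℕ)) + tsize (suppVars E) + 1) + 1) + 1) + 1 := rfl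
    -- At most `2 ^ n ≤ M ≤ N` lists arise at any stage of the loop, and the factor `2 * D.eval N +
    -- 4` bounds the contribution of each.
    obtain ⟨t₅, ht₅, hr₅⟩ := hsub x.2 [[]] (suppVars E) (N * (2 * D.eval N + 4)) fun l' hl' => by
      refine (tsize_sublistsOf_le l').trans (Nat.mul_le_mul ?_ ?_)
      · exact (Nat.pow_le_pow_right (by norm_num) hl'.length_le).trans ((hM hl).trans (by omega))
      · have := tsize_le_of_sublist hl'.sublist
        omega
    have e₅ : t₅ ≤ U'.eval N := by
      refine ht₅.trans ?_
      simp only [U', Polynomial.eval_add, Polynomial.eval_mul, Polynomial.eval_comp,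
        Polynomial.eval_ofNat, Polynomial.eval_X]
      exact eval_le_eval U (by omega)
    obtain ⟨t₆, ht₆, hr₆⟩ := hsch ((x.2, E), sublistsOf (suppVars E))
    have e₆ := eval_le_eval W (show tsize ((x.2, E), sublistsOf (suppVars E)) ≤
        D.eval N + U'.eval N + 1 by
      have := hr₅.size_le.2.trans e₅
      change tsize (sublistsOf (suppVars E)) ≤ _ at this
      rw [tsize_pair, tsize_pair]
      omega)
    exact ⟨_, by omega, .comp hr₀ (.branch_false hr₁' (.comp (.pair hr₂ (.comp hr₃ hr₅)) hr₆))⟩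

/-! ### Bounds -/

/-- The sum is at most twice its larger summand. This separates the part of the running time that
depends on the instance from the part that depends on `k`. -/
theorem eval_add_le (R : Polynomial ℕ) (a b : ℕ) :
    R.eval (a + b) ≤ R.eval (2 * a) + R.eval (2 * b) := by
  rcases le_total a b with h | h
  · exact (eval_le_eval R (by omega)).trans (Nat.le_add_left _ _)
  · exact (eval_le_eval R (by omega)).trans (Nat.le_add_right _ _)

theorem eval_le_mul_pow (R : Polynomial ℕ) {n : ℕ} (hn : 0 < n) :
    R.eval n ≤ R.eval 1 * n ^ R.natDegree := by
  rw [Polynomial.eval_eq_sum_range, Polynomial.eval_eq_sum_range, Finset.sum_mul]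
  refine Finset.sum_le_sum fun i hi => ?_
  rw [one_pow, mul_one]
  exact Nat.mul_le_mul_left _ (Nat.pow_le_pow_right hn (by
    have := Finset.mem_range.1 hi; omega))

/-- A polynomial of `2 ^ O(k)` is again `2 ^ O(k)`. In the argument, `4 * k + 2` accounts for the
parameter in the input and `2 ^ (2 * r * k)` for the assignments searched. -/
theorem exists_eval_le_two_pow (R : Polynomial ℕ) (r : ℕ) :
    ∃ c, ∀ k, R.eval (2 * (4 * k + 2 + 2 ^ (2 * r * k))) ≤ 2 ^ (c * (k + 1)) := by
  refine ⟨R.eval 1 + (2 * r + 4) * R.natDegree, fun k => ?_⟩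
  have h₁ : 2 * (4 * k + 2 + 2 ^ (2 * r * k)) ≤ 2 ^ ((2 * r + 4) * (k + 1)) := by
    have h₂ : k + 1 ≤ 2 ^ k := Nat.lt_two_pow_self
    have h₃ : 2 ^ (2 * r * k) ≤ 2 ^ (2 * r * k + k) := Nat.pow_le_pow_right (by norm_num) (by omega)
    have h₄ : 2 ^ k ≤ 2 ^ (2 * r * k + k) := Nat.pow_le_pow_right (by norm_num) (by omega)
    have h₅ : 2 ^ (2 * r * k + k + 4) ≤ 2 ^ ((2 * r + 4) * (k + 1)) :=
      Nat.pow_le_pow_right (by norm_num) (by ring_nf; omega)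
    rw [pow_add _ _ 4] at h₅
    omega
  have h₂ := (eval_le_eval R h₁).trans (eval_le_mul_pow R (by positivity))
  refine h₂.trans ?_
  have h₃ : 2 ^ ((R.eval 1 + (2 * r + 4) * R.natDegree) * (k + 1)) =
      2 ^ (R.eval 1 * (k + 1)) * (2 ^ ((2 * r + 4) * (k + 1))) ^ R.natDegree := by
    rw [← pow_mul, ← pow_add]
    congr 1
    ring
  rw [h₃]
  refine Nat.mul_le_mul_right _ ?_
  exact Nat.lt_two_pow_self.le.trans (Nat.pow_le_pow_right (by norm_num)
    (Nat.le_mul_of_pos_right _ (by omega)))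

theorem isBigOKLogK_mul_succ (c : ℕ) : IsBigOKLogK fun k => c * (k + 1) := by
  refine IsBigO.of_bound (2 * c) ?_
  -- From `k = 3 > e` on the logarithm is at least one, so a linear bound is already `O(k log k)`.
  filter_upwards [eventually_ge_atTop 3] with k hk
  have hk' : (3 : ℝ) ≤ k := by exact_mod_cast hk
  have hlog : 1 ≤ Real.log k := by
    rw [Real.le_log_iff_exp_le (by linarith)]
    linarith [Real.exp_one_lt_d9]
  have h : (k : ℝ) ≤ k * Real.log k := le_mul_of_one_le_right (by linarith) hlog
  rw [Real.norm_of_nonneg (by positivity), Real.norm_of_nonneg (by linarith), mul_comm (2 : ℝ),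
    mul_assoc]
  push_cast
  exact mul_le_mul_of_nonneg_left (by linarith) (by positivity)

theorem encTable_size_lt (a : ℕ) (f : (Fin a → Bool) → Bool) :
    (encTable a f).size + 1 ≤ 4 * 2 ^ a := by
  induction a with
  | zero => rw [encTable]; cases f Fin.elim0 <;> simp [encBool, BTree.size]
  | succ a ih =>
    have h₁ := ih fun v => f (Fin.cons false v)
    have h₂ := ih fun v => f (Fin.cons true v)
    rw [encTable, BTree.size, pow_succ]
    omega

theorem CSP.numVars_le {r : ℕ} {I : CSP r} (h : I.AllVarsOccur) :
    I.numVars ≤ I.numConstraints * r := by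
  have h₁ : Fintype.card (Fin I.numVars) ≤
      (I.constraints.flatMap fun c => c.vars).toFinset.card := by
    rw [← Finset.card_univ]
    refine Finset.card_le_card fun i _ => ?_
    obtain ⟨c, hc, hi⟩ := h i
    exact List.mem_toFinset.2 (List.mem_flatMap.2 ⟨c, hc, hi⟩)
  rw [Fintype.card_fin] at h₁
  refine h₁.trans ((List.toFinset_card_le _).trans ?_)
  rw [CSP.numConstraints]
  induction I.constraints with
  | nil => simp
  | cons c l ih =>
    rw [List.flatMap_cons, List.length_append, List.length_cons, Nat.succ_mul]
    have := c.length_le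
    omega

/-- If every variable occurs, there are at most `r * m` of them. Truth tables have size `O(2 ^ r)`,
a constant, so the whole instance has size polynomial in `m`. -/
theorem CSP.exists_enc_size_le (r : ℕ) : ∃ Q : Polynomial ℕ, ∀ I : CSP r, I.AllVarsOccur →
    (CSP.enc I).size ≤ Q.eval I.numConstraints := by
  refine ⟨4 * (.X * (r : Polynomial ℕ)) + 1 + (.X * ((r : Polynomial ℕ) *
    (4 * (.X * (r : Polynomial ℕ)) + 2) + 4 * 2 ^ r + 2 + 1) + 1) + 1, fun I h => ?_⟩
  simp only [Polynomial.eval_add, Polynomial.eval_mul, Polynomial.eval_pow, Polynomial.eval_ofNat,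
    Polynomial.eval_one, Polynomial.eval_X, Polynomial.eval_natCast]
  have hn := I.numVars_le h
  have h₁ := encNat_size_le I.numVars
  have h₂ := encList_size_le (e := Constraint.enc) (l := I.constraints)
    (B := r * (4 * (I.numConstraints * r) + 2) + 4 * 2 ^ r + 2) (fun c _ => by
      have h₁ := encVars_size_le c.vars c.length_le
      have h₂ := encTable_size_lt _ c.table
      have h₃ : 2 ^ c.vars.length ≤ 2 ^ r := Nat.pow_le_pow_right (by norm_num) c.length_le
      have h₄ : r * (4 * I.numVars + 2) ≤ r * (4 * (I.numConstraints * r) + 2) :=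
        Nat.mul_le_mul_left _ (by omega)
      simp only [Constraint.enc, BTree.size]
      omega) le_rfl
  simp only [CSP.enc, BTree.size, Nat.cast_id]
  change _ ≤ I.numConstraints * _ + 1 at h₂
  omega

theorem mainTheorem9 (r : ℕ) (hr : 2 ≤ r) :
    (∃ F : CSP r → ℕ → LinSystem r × ℕ,
      IsBikernelization (MaxCSP r) (MaxLinAA r) F ∧
      ∃ g : ℕ → ℕ, IsBigOKLogK g ∧ ∀ I k, (F I k).1.numVars ≤ g k) ∧
    (∃ (p : Prog) (g : ℕ → ℕ) (P Q : Polynomial ℕ), IsBigOKLogK g ∧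
      ∀ (I : CSP r) (k : ℕ), ∃ (b : Bool) (t : ℕ),
        p.Runs ((MaxCSP r).code I k) (encBool b) t ∧
        (b = true ↔ (MaxCSP r).Yes I k) ∧
        t ≤ 2 ^ g k + P.eval (CSP.enc I).size ∧
        (I.AllVarsOccur → t ≤ 2 ^ g k + Q.eval I.numConstraints)) := by
  have hr0 : 0 < r := by omega
  refine ⟨⟨kernel, isBikernelization_kernel hr0, fun k => 2 * r * (k + 1),
    isBigOKLogK_mul_succ _, fun I k => (numVars_kernel_le hr0 I k).trans
      (Nat.mul_le_mul_left _ (Nat.le_succ k))⟩, ?_⟩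
  obtain ⟨p, R, hp⟩ := search_runs r
  obtain ⟨c, hc⟩ := exists_eval_le_two_pow R r
  obtain ⟨Q, hQ⟩ := CSP.exists_enc_size_le r
  refine ⟨p, fun k => c * (k + 1), R.comp (2 * .X), R.comp (2 * Q), isBigOKLogK_mul_succ _,
    fun I k => ?_⟩
  obtain ⟨t, ht, hrun⟩ := hp ((I.numVars, I.raw), k) (2 ^ (2 * r * k)) fun h => by
    refine Nat.pow_le_pow_right (by norm_num) ?_
    have h' : ¬isLarge r (reduced r I.raw) k = true := by rw [h]; simp
    rw [isLarge_iff hr0, not_or] at h'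
    exact not_lt.1 h'.2
  have hsize : tsize ((I.numVars, I.raw), k) = (CSP.enc I).size + (encNat k).size + 1 :=
    congrArg BTree.size (I.enc_raw k).symm
  have ht' : t ≤ 2 ^ (c * (k + 1)) + R.eval (2 * (CSP.enc I).size) := by
    have h₁ := encNat_size_le k
    have h₂ := eval_le_eval R (show tsize ((I.numVars, I.raw), k) + 2 ^ (2 * r * k) ≤
      (CSP.enc I).size + (4 * k + 2 + 2 ^ (2 * r * k)) by omega)
    have h₃ := eval_add_le R (CSP.enc I).size (4 * k + 2 + 2 ^ (2 * r * k))
    have h₄ := hc k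
    omega
  refine ⟨_, t, ?_, I.yes_iff_search hr0 k, ?_, fun h => ?_⟩
  · rw [I.enc_raw]
    exact hrun
  · simpa [Polynomial.eval_comp] using ht'
  · refine ht'.trans (Nat.add_le_add_left ?_ _)
    simpa [Polynomial.eval_comp] using eval_le_eval R (Nat.mul_le_mul_left 2 (hQ I h))
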